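/- Let $H$ and $H_n$ ($n\in\mathbb N$) be complex Hilbert spaces, $J_n\colon H\to H_n$ bounded linear operators, and $A$ on $H$, $A_n$ on $H_n$ (possibly unbounded) self-adjoint operators. Write $R_A(z)=(A-z)^{-1}$ and $\Gamma=\mathbb C\setminus\overline{\sigma(A)\cup\bigcup_n\sigma(A_n)}$, and for a function $f$ let $f(A)$ be given by the functional calculus of $A$. We say that $A_n\to A$ in generalized strong resolvent sense if $\sup_n\|J_n\|<\infty$, $J_n^*J_n\psi\to\psi$ for all $\psi\in H$, and for some non-real $z\in\Gamma$ one has $J_n^*R_{A_n}(z)J_n\psi\to R_A(z)\psi$ for all $\psi\in H$. We say that $A_n\to A$ in generalized norm resolvent sense if $\sup_n\|J_n\|<\infty$, $\|J_n^*J_n-\mathbb I\|\to0$, $\|J_nJ_n^*-\mathbb I\|\to0$, and $\|J_n^*R_{A_n}(z)J_n-R_A(z)\|\to0$ for some $z\in\Gamma$. (i) If $A_n\to A$ in generalized strong resolvent sense, then $J_n^*e^{\mathrm i tA_n}J_n\psi\to e^{\mathrm i tA}\psi$ for all $t\in\mathbb R$ and $\psi\in H$. (ii) If $A_n\to A$ in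 generalized strong resolvent sense and there is $\gamma\in\mathbb R$ with $A\ge\gamma$ and $A_n\ge\gamma$ for all $n$, then $J_n^*e^{-tA_n}J_n\psi\to e^{-tA}\psi$ for all $t\ge0$ and $\psi\in H$. (iii) If $A_n\to A$ in generalized norm resolvent sense and there is $\gamma\in\mathbb R$ with $A\ge\gamma$ and $A_n\ge\gamma$ for all $n$, then $\|J_n^*e^{-tA_n}J_n-e^{-tA}\|\to0$ for all $t\ge0$. -/

import Mathlib

open Filter Topology MeasureTheory

noncomputable section

namespace LinearPMap

variable {H : Type*} [NormedAddCommGroup H] [InnerProductSpace ℂ H]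

/-- `R` is the bounded, everywhere defined two-sided inverse of `A - z : D(A) → H`. -/
def IsResolventAt (A : H →ₗ.[ℂ] H) (z : ℂ) (R : H →L[ℂ] H) : Prop :=
  (∀ ψ : H, ∃ h : R ψ ∈ A.domain, A ⟨R ψ, h⟩ - z • R ψ = ψ) ∧
    ∀ u : A.domain, R (A u - z • (u : H)) = u

/-- The resolvent set of an unbounded operator. -/
def resolventSet (A : H →ₗ.[ℂ] H) : Set ℂ := {z | ∃ R : H →L[ℂ] H, A.IsResolventAt z R}

/-- The spectrum `σ(A)` of an unbounded operator. -/
def spectrum (A : H →ₗ.[ℂ] H) : Set ℂ := A.resolventSetᶜ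

open Classical in
/-- The resolvent `R_A(z) = (A - z)⁻¹`; it is set to `0` when `z ∈ σ(A)`. -/
def resolvent (A : H →ₗ.[ℂ] H) (z : ℂ) : H →L[ℂ] H :=
  if h : ∃ R : H →L[ℂ] H, A.IsResolventAt z R then h.choose else 0

/-- `A ≥ γ` in the sense of quadratic forms. -/
def IsBoundedBelowBy (A : H →ₗ.[ℂ] H) (γ : ℝ) : Prop :=
  ∀ u : A.domain, γ * ‖(u : H)‖ ^ 2 ≤ (inner ℂ (u : H) (A u)).re

/-- `μ` is the spectral measure of the self-adjoint operator `A` at the vector `ψ`, that is,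
`μ(B) = ⟪ψ, P_A(B) ψ⟫` for the projection-valued measure `P_A` of `A`. It is the unique finite
Borel measure on `ℝ` whose Borel (Stieltjes) transform is `z ↦ ⟪ψ, R_A(z) ψ⟫`. -/
def IsSpectralMeasure (A : H →ₗ.[ℂ] H) (ψ : H) (μ : Measure ℝ) : Prop :=
  IsFiniteMeasure μ ∧
    ∀ z : ℂ, z.im ≠ 0 → inner ℂ ψ (A.resolvent z ψ) = ∫ x : ℝ, ((x : ℂ) - z)⁻¹ ∂μ

/-- The bounded operator `T` is `f(A) = ∫ f dP_A`, the value at `f : ℝ → ℂ` of the functional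
calculus of the self-adjoint operator `A`: for all `ψ`, the function `f` is integrable for the
spectral measure `μ_ψ` of `A` at `ψ` and `⟪ψ, T ψ⟫ = ∫ f dμ_ψ`. (On a complex space the quadratic
form determines `T`.) Only the values of `f` on the spectrum of `A` matter. -/
def IsFunctionOf (A : H →ₗ.[ℂ] H) (f : ℝ → ℂ) (T : H →L[ℂ] H) : Prop :=
  ∀ ψ : H, ∃ μ : Measure ℝ, A.IsSpectralMeasure ψ μ ∧ Integrable f μ ∧
    inner ℂ ψ (T ψ) = ∫ x : ℝ, f x ∂μ

open Classical in
/-- The bounded operator `f(A)` for a self-adjoint operator `A` and a Borel function `f` that is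
bounded on the spectrum of `A`; the value is `0` if no bounded operator is `f(A)`. -/
def functionOf (A : H →ₗ.[ℂ] H) (f : ℝ → ℂ) : H →L[ℂ] H :=
  if h : ∃ T : H →L[ℂ] H, A.IsFunctionOf f T then h.choose else 0

/-- The unitary group `e^{itA}`. -/
def unitaryGroup (A : H →ₗ.[ℂ] H) (t : ℝ) : H →L[ℂ] H :=
  A.functionOf fun x => Complex.exp (Complex.I * t * x)

/-- The semigroup `e^{-tA}`. -/
def heatSemigroup (A : H →ₗ.[ℂ] H) (t : ℝ) : H →L[ℂ] H :=
  A.functionOf fun x => Complex.exp (-t * x)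

end LinearPMap

section GeneralizedResolventConvergence

variable {H : Type*} [NormedAddCommGroup H] [InnerProductSpace ℂ H] [CompleteSpace H]
  {K : ℕ → Type*} [∀ n, NormedAddCommGroup (K n)] [∀ n, InnerProductSpace ℂ (K n)]
  [∀ n, CompleteSpace (K n)]

/-- `‖J_n‖ ≤ C` and `J_n* J_n → 1` strongly. -/
def StrongIdentification (J : ∀ n, H →L[ℂ] K n) : Prop :=
  (∃ C : ℝ, ∀ n, ‖J n‖ ≤ C) ∧
    ∀ ψ : H, Tendsto (fun n => (J n).adjoint (J n ψ)) atTop (𝓝 ψ)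

/-- `‖J_n‖ ≤ C`, `‖J_n* J_n - 1‖ → 0` and `‖J_n J_n* - 1‖ → 0`. -/
def NormIdentification (J : ∀ n, H →L[ℂ] K n) : Prop :=
  (∃ C : ℝ, ∀ n, ‖J n‖ ≤ C) ∧
    Tendsto (fun n => ‖(J n).adjoint ∘L J n - ContinuousLinearMap.id ℂ H‖) atTop (𝓝 0) ∧
    Tendsto (fun n => ‖J n ∘L (J n).adjoint - ContinuousLinearMap.id ℂ (K n)‖) atTop (𝓝 0)

/-- `Γ = ℂ \ Σ`, where `Σ` is the closure of `σ(A) ∪ ⋃ₙ σ(A_n)`. -/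
def commonResolventSet (A : H →ₗ.[ℂ] H) (An : ∀ n, K n →ₗ.[ℂ] K n) : Set ℂ :=
  (closure (A.spectrum ∪ ⋃ n, (An n).spectrum))ᶜ

/-- Generalized strong resolvent convergence of `A_n` to `A`, with convergence at one non-real
point of `Γ`. -/
def GeneralizedStrongResolventConvergence (J : ∀ n, H →L[ℂ] K n) (An : ∀ n, K n →ₗ.[ℂ] K n)
    (A : H →ₗ.[ℂ] H) : Prop :=
  StrongIdentification J ∧ ∃ z ∈ commonResolventSet A An, z.im ≠ 0 ∧
    ∀ ψ : H, Tendsto (fun n => (J n).adjoint ((An n).resolvent z (J n ψ))) atTop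
      (𝓝 (A.resolvent z ψ))

/-- Generalized norm resolvent convergence of `A_n` to `A`, with convergence at one point
of `Γ`. -/
def GeneralizedNormResolventConvergence (J : ∀ n, H →L[ℂ] K n) (An : ∀ n, K n →ₗ.[ℂ] K n)
    (A : H →ₗ.[ℂ] H) : Prop :=
  NormIdentification J ∧ ∃ z ∈ commonResolventSet A An,
    Tendsto (fun n => ‖(J n).adjoint ∘L (An n).resolvent z ∘L J n - A.resolvent z‖) atTop (𝓝 0)

end GeneralizedResolventConvergence

end

/-! The maps `T ↦ J_n* T J_n` are not multiplicative, so the proof replaces the two-sided relation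
by a one-sided one: `T_n J_n - J_n S → 0`, tested along constant sequences of vectors (strong case)
or along all bounded sequences (norm case). This relation passes to sums, products and uniform
limits.

It is available for the resolvents at the given point. In the strong case one expands `‖R_n J_n ψ -
J_n R ψ‖²`; its only delicate term is `‖R_n J_n ψ‖² = Im ⟪J_n ψ, R_n J_n ψ⟫ / Im z`, which converges
by hypothesis. In the norm case `J_n J_n* ≈ 1` cancels `J_n*`. The resolvent identity moves the
relation to every non-real point, and Stone–Weierstrass extends it to `f(A)` for all `f` continuous
and vanishing at infinity (`AsymptoticallyIntertwines.vanishingCalculus`). For bounded continuous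
`f`, strong convergence follows on the dense range of `R_A(i)`, because `f(x)(x - i)⁻¹` vanishes at
infinity. Applying `J_n*` and `J_n* J_n → 1` restores the two-sided form.

The function `e^{itx}` is bounded; `e^{-tx}` may be altered below `γ`, and then vanishes at infinity
if `t > 0`.

Since `functionOf` is defined by spectral measures, they must be produced: the calculus for
vanishing functions is built from the normal operator `R_A(i)`, Riesz–Markov gives the measures, and
injectivity of the Borel transform identifies the two definitions. -/

noncomputable section

/-! ### Resolvents of self-adjoint operators -/

namespace LinearPMap

variable {H : Type*} [NormedAddCommGroup H] [InnerProductSpace ℂ H]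
variable {A : H →ₗ.[ℂ] H}

theorem IsResolventAt.unique {z : ℂ} {R S : H →L[ℂ] H} (hR : A.IsResolventAt z R)
    (hS : A.IsResolventAt z S) : R = S := by
  ext ψ
  obtain ⟨h, e⟩ := hS.1 ψ
  have := hR.2 ⟨S ψ, h⟩
  rwa [e] at this

theorem IsResolventAt.resolvent_eq {z : ℂ} {R : H →L[ℂ] H} (hR : A.IsResolventAt z R) :
    A.resolvent z = R := by
  have h : ∃ R : H →L[ℂ] H, A.IsResolventAt z R := ⟨R, hR⟩
  rw [resolvent, dif_pos h]
  exact h.choose_spec.unique hR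

theorem isResolventAt_resolvent {z : ℂ} (hz : z ∈ A.resolventSet) :
    A.IsResolventAt z (A.resolvent z) := by
  obtain ⟨R, hR⟩ := hz
  rwa [hR.resolvent_eq]

/-- The first resolvent identity. -/
theorem resolvent_sub_resolvent {z w : ℂ} (hz : z ∈ A.resolventSet) (hw : w ∈ A.resolventSet) :
    A.resolvent z - A.resolvent w = (z - w) • (A.resolvent z ∘L A.resolvent w) := by
  ext ψ
  obtain ⟨h, e⟩ := (isResolventAt_resolvent hw).1 ψ
  have h2 : A.resolvent z (A ⟨_, h⟩ - z • A.resolvent w ψ) = A.resolvent w ψ :=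
    (isResolventAt_resolvent hz).2 ⟨_, h⟩
  have e2 : A ⟨_, h⟩ - z • A.resolvent w ψ = ψ + (w - z) • A.resolvent w ψ := by
    rw [sub_eq_iff_eq_add.1 e]
    module
  rw [e2, _root_.map_add, _root_.map_smul] at h2
  simp only [_root_.sub_apply, _root_.smul_apply, ContinuousLinearMap.comp_apply]
  rw [← sub_eq_zero] at h2 ⊢
  rw [← h2]
  module

theorem resolvent_commute {z w : ℂ} (hz : z ∈ A.resolventSet) (hw : w ∈ A.resolventSet) :
    Commute (A.resolvent z) (A.resolvent w) := by
  rcases eq_or_ne z w with rfl | hne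
  · exact Commute.refl _
  · have h1 := resolvent_sub_resolvent hz hw
    have h2 := resolvent_sub_resolvent hw hz
    have h3 : (z - w) • (A.resolvent z ∘L A.resolvent w) =
        (z - w) • (A.resolvent w ∘L A.resolvent z) := by
      rw [← h1, ← neg_sub (A.resolvent w), h2, ← neg_smul, neg_sub]
    exact smul_right_injective _ (sub_ne_zero.2 hne) h3

variable [CompleteSpace H]

theorem _root_.IsSelfAdjoint.inner_apply_eq (hA : IsSelfAdjoint A) (u v : A.domain) :
    inner ℂ (A u) (v : H) = inner ℂ (u : H) (A v) := by
  have h := adjoint_isFormalAdjoint hA.dense_domain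
  rw [isSelfAdjoint_def.1 hA] at h
  exact h u v

/-- As `⟪u, A u⟫` is real, `Im ⟪u, (A - z) u⟫ = -Im z ‖u‖²`; conclude by Cauchy–Schwarz. -/
theorem _root_.IsSelfAdjoint.abs_im_mul_norm_le (hA : IsSelfAdjoint A) (z : ℂ) (u : A.domain) :
    |z.im| * ‖(u : H)‖ ≤ ‖A u - z • (u : H)‖ := by
  have h1 : (inner ℂ (u : H) (A u)).im = 0 := by
    have h := inner_conj_symm (𝕜 := ℂ) (u : H) (A u)
    rw [hA.inner_apply_eq] at h
    exact Complex.conj_eq_iff_im.1 h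
  have h2 : (inner ℂ (u : H) (A u - z • (u : H))).im = -(z.im * ‖(u : H)‖ ^ 2) := by
    rw [inner_sub_right, inner_smul_right, inner_self_eq_norm_sq_to_K, Complex.sub_im, h1]
    simp [← Complex.ofReal_pow, Complex.mul_im]
  have h3 : |z.im| * ‖(u : H)‖ ^ 2 ≤ ‖(u : H)‖ * ‖A u - z • (u : H)‖ := by
    calc |z.im| * ‖(u : H)‖ ^ 2 = |(inner ℂ (u : H) (A u - z • (u : H))).im| := by
          rw [h2, abs_neg, abs_mul, abs_of_nonneg (sq_nonneg ‖(u : H)‖)]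
      _ ≤ ‖inner ℂ (u : H) (A u - z • (u : H))‖ := Complex.abs_im_le_norm _
      _ ≤ _ := norm_inner_le_norm _ _
  rcases (norm_nonneg (u : H)).eq_or_lt with h | h
  · simp [← h]
  · refine le_of_mul_le_mul_left ?_ h
    linarith

/-- The map `(u, A u) ↦ (A - z) u` on the graph of `A`. -/
def graphSubSMul (A : H →ₗ.[ℂ] H) (z : ℂ) : A.graph →L[ℂ] H :=
  (ContinuousLinearMap.snd ℂ H H - z • ContinuousLinearMap.fst ℂ H H) ∘L A.graph.subtypeL

/-- On the graph, which is complete because `A` is closed, `A - z` is a bounded map. The previous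
estimate bounds it below, so it is injective with closed range. A vector orthogonal to the range
lies in the domain of `A† = A` and is an eigenvector for `star z` unless zero, which the same
estimate excludes. -/
theorem graphSubSMul_bijective (hA : IsSelfAdjoint A) {z : ℂ} (hz : z.im ≠ 0) :
    Function.Bijective (graphSubSMul A z) := by
  have hz' : 0 < |z.im| := abs_pos.2 hz
  have key : ∀ p : A.graph, ‖(p : H × H).1‖ ≤ |z.im|⁻¹ * ‖graphSubSMul A z p‖ := by
    rintro ⟨⟨a, b⟩, hp⟩
    obtain ⟨u, rfl, rfl⟩ := A.mem_graph_iff.1 hp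
    rw [inv_mul_eq_div, le_div_iff₀' hz']
    exact hA.abs_im_mul_norm_le z u
  have hanti : ∃ c, AntilipschitzWith c (graphSubSMul A z) := by
    set C : ℝ := |z.im|⁻¹ * (1 + ‖z‖) + 1 with hC
    have hC0 : 0 ≤ C := by positivity
    refine ⟨C.toNNReal, (graphSubSMul A z).antilipschitz_of_bound fun p => ?_⟩
    have h1 := key p
    have h2 : ‖(p : H × H).2‖ ≤ ‖graphSubSMul A z p‖ + ‖z‖ * ‖(p : H × H).1‖ := by
      have : (p : H × H).2 = graphSubSMul A z p + z • (p : H × H).1 := by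
        simp [graphSubSMul]
      rw [this, ← norm_smul]
      exact norm_add_le _ _
    have h3 : ‖p‖ = max ‖(p : H × H).1‖ ‖(p : H × H).2‖ := rfl
    have h4 : ‖z‖ * ‖(p : H × H).1‖ ≤ ‖z‖ * (|z.im|⁻¹ * ‖graphSubSMul A z p‖) := by gcongr
    have h5 : 0 ≤ ‖graphSubSMul A z p‖ := norm_nonneg _
    have h6 : 0 ≤ |z.im|⁻¹ * ‖graphSubSMul A z p‖ := by positivity
    have h7 : 0 ≤ ‖z‖ * (|z.im|⁻¹ * ‖graphSubSMul A z p‖) := by positivity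
    rw [h3, Real.coe_toNNReal C hC0, hC]
    refine max_le ?_ ?_ <;> nlinarith
  obtain ⟨c, hc⟩ := hanti
  refine ⟨hc.injective, ?_⟩
  have hclosed : _root_.IsClosed (A.graph : Set (H × H)) := hA.isClosed
  have : CompleteSpace A.graph := hclosed.completeSpace_coe
  have hrange : _root_.IsClosed ((graphSubSMul A z).range : Set H) := by
    rw [LinearMap.coe_range]
    exact hc.isClosed_range (graphSubSMul A z).uniformContinuous
  rw [← ContinuousLinearMap.coe_coe, ← LinearMap.range_eq_top]
  have : CompleteSpace (graphSubSMul A z).range := hrange.completeSpace_coe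
  rw [← Submodule.orthogonal_eq_bot_iff, Submodule.eq_bot_iff]
  intro φ hφ
  rw [Submodule.mem_orthogonal'] at hφ
  have horth : ∀ u : A.domain, inner ℂ φ (A u - z • (u : H)) = 0 := fun u =>
    hφ _ ⟨⟨((u : H), A u), A.mem_graph u⟩, rfl⟩
  have hadj : ∀ u : A.domain, inner ℂ (star z • φ) (u : H) = inner ℂ φ (A u) := fun u => by
    have := horth u
    rw [inner_sub_right, inner_smul_right, sub_eq_zero] at this
    rw [this, inner_smul_left]
    simp
  have hmem : φ ∈ A†.domain := mem_adjoint_domain_of_exists φ ⟨star z • φ, hadj⟩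
  have happ : A† ⟨φ, hmem⟩ = star z • φ := adjoint_apply_eq hA.dense_domain _ hadj
  have hself : A† = A := isSelfAdjoint_def.1 hA
  have hgr : (φ, star z • φ) ∈ A.graph := by
    rw [← hself, ← happ]
    exact A†.mem_graph ⟨φ, hmem⟩
  obtain ⟨u, hu1, hu2⟩ := A.mem_graph_iff.1 hgr
  have := hA.abs_im_mul_norm_le (star z) u
  simp only at hu1 hu2
  rw [hu1, hu2, sub_self, norm_zero] at this
  have h9 : |(star z).im| = |z.im| := by simp
  rw [h9] at this
  exact norm_le_zero_iff.1 (by nlinarith [norm_nonneg φ])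

theorem _root_.IsSelfAdjoint.mem_resolventSet (hA : IsSelfAdjoint A) {z : ℂ} (hz : z.im ≠ 0) :
    z ∈ A.resolventSet := by
  have hb := graphSubSMul_bijective hA hz
  have hclosed : _root_.IsClosed (A.graph : Set (H × H)) := hA.isClosed
  have : CompleteSpace A.graph := hclosed.completeSpace_coe
  let e := ContinuousLinearEquiv.ofBijective (graphSubSMul A z)
    (LinearMap.ker_eq_bot.2 hb.1) (LinearMap.range_eq_top.2 hb.2)
  have he : ∀ p, e p = graphSubSMul A z p := fun p => rfl
  refine ⟨ContinuousLinearMap.fst ℂ H H ∘L A.graph.subtypeL ∘L e.symm.toContinuousLinearMap,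
    fun ψ => ?_, fun u => ?_⟩
  · have h1 : e (e.symm ψ) = ψ := e.apply_symm_apply ψ
    rw [he] at h1
    obtain ⟨u, hu1, hu2⟩ := A.mem_graph_iff.1 (e.symm ψ).2
    have hmem : ((e.symm ψ : A.graph) : H × H).1 ∈ A.domain := hu1 ▸ u.2
    refine ⟨hmem, ?_⟩
    have hu3 : A ⟨((e.symm ψ : A.graph) : H × H).1, hmem⟩ = ((e.symm ψ : A.graph) : H × H).2 := by
      rw [← hu2]
      congr 1
      exact Subtype.ext hu1.symm
    exact (congrArg (· - z • ((e.symm ψ : A.graph) : H × H).1) hu3).trans h1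
  · have : e ⟨((u : H), A u), A.mem_graph u⟩ = A u - z • (u : H) := rfl
    rw [← this]
    simp

theorem norm_resolvent_le (hA : IsSelfAdjoint A) {z : ℂ} (hz : z.im ≠ 0) :
    ‖A.resolvent z‖ ≤ |z.im|⁻¹ := by
  refine ContinuousLinearMap.opNorm_le_bound _ (by positivity) fun ψ => ?_
  obtain ⟨h, e⟩ := (isResolventAt_resolvent (hA.mem_resolventSet hz)).1 ψ
  have := hA.abs_im_mul_norm_le z ⟨_, h⟩
  rw [e] at this
  rwa [inv_mul_eq_div, le_div_iff₀' (abs_pos.2 hz)]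

theorem adjoint_resolvent (hA : IsSelfAdjoint A) {z : ℂ} (hz : z.im ≠ 0) :
    (A.resolvent z).adjoint = A.resolvent (star z) := by
  symm
  rw [ContinuousLinearMap.eq_adjoint_iff]
  intro φ ψ
  obtain ⟨hv, ev⟩ := (isResolventAt_resolvent (hA.mem_resolventSet hz)).1 ψ
  have hz' : (star z).im ≠ 0 := by simpa using hz
  obtain ⟨hu, eu⟩ := (isResolventAt_resolvent (hA.mem_resolventSet hz')).1 φ
  have h := hA.inner_apply_eq ⟨_, hu⟩ ⟨_, hv⟩
  rw [sub_eq_iff_eq_add.1 ev, sub_eq_iff_eq_add.1 eu, inner_add_left, inner_add_right,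
    inner_smul_left, inner_smul_right] at h
  simp only [starRingEnd_apply, star_star] at h
  exact (add_right_cancel h).symm

theorem dense_range_resolvent (hA : IsSelfAdjoint A) {z : ℂ} (hz : z.im ≠ 0) :
    DenseRange (A.resolvent z) := by
  refine hA.dense_domain.mono fun u hu => ?_
  exact ⟨_, (isResolventAt_resolvent (hA.mem_resolventSet hz)).2 ⟨u, hu⟩⟩

theorem isStarNormal_resolvent (hA : IsSelfAdjoint A) {z : ℂ} (hz : z.im ≠ 0) :
    IsStarNormal (A.resolvent z) := by
  have hz' : (star z).im ≠ 0 := by simpa using hz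
  refine ⟨?_⟩
  rw [ContinuousLinearMap.star_eq_adjoint, adjoint_resolvent hA hz]
  exact resolvent_commute (hA.mem_resolventSet hz') (hA.mem_resolventSet hz)

end LinearPMap

/-! ### Continuous functions vanishing at infinity, and cutoffs -/

/-- A continuous function on the line that vanishes at infinity. -/
def IsVanishing (f : ℝ → ℂ) : Prop := Continuous f ∧ Tendsto f (cocompact ℝ) (𝓝 0)

namespace IsVanishing

variable {f g : ℝ → ℂ}

theorem add (hf : IsVanishing f) (hg : IsVanishing g) : IsVanishing fun x => f x + g x :=
  ⟨hf.1.add hg.1, by simpa using hf.2.add hg.2⟩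

theorem sub (hf : IsVanishing f) (hg : IsVanishing g) : IsVanishing fun x => f x - g x :=
  ⟨hf.1.sub hg.1, by simpa using hf.2.sub hg.2⟩

theorem const_mul (hf : IsVanishing f) (c : ℂ) : IsVanishing fun x => c * f x :=
  ⟨hf.1.const_mul c, by simpa using hf.2.const_mul c⟩

theorem star (hf : IsVanishing f) : IsVanishing fun x => star (f x) :=
  ⟨hf.1.star, by simpa using hf.2.star⟩

theorem bounded_mul (hg : IsVanishing g) (hf : Continuous f) {C : ℝ} (hC : ∀ x, ‖f x‖ ≤ C) :
    IsVanishing fun x => f x * g x := by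
  refine ⟨hf.mul hg.1, ?_⟩
  refine squeeze_zero_norm (a := fun x => C * ‖g x‖) (fun x => ?_) ?_
  · rw [norm_mul]
    exact mul_le_mul_of_nonneg_right (hC x) (norm_nonneg _)
  · simpa using hg.2.norm.const_mul C

theorem exists_norm_lt (hf : IsVanishing f) {ε : ℝ} (hε : 0 < ε) :
    ∃ M : ℝ, ∀ x, M ≤ |x| → ‖f x‖ < ε := by
  have h := hf.2.norm.eventually_lt_const (by simpa using hε)
  rw [← Metric.cobounded_eq_cocompact, ← comap_norm_atTop, eventually_comap] at h
  obtain ⟨M, hM⟩ := eventually_atTop.1 h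
  exact ⟨M, fun x hx => hM _ hx x rfl⟩

theorem of_exists_norm_lt (hf : Continuous f)
    (h : ∀ ε : ℝ, 0 < ε → ∃ M : ℝ, ∀ x, M ≤ |x| → ‖f x‖ < ε) : IsVanishing f := by
  refine ⟨hf, ?_⟩
  rw [Metric.tendsto_nhds]
  intro ε hε
  rw [← Metric.cobounded_eq_cocompact, ← comap_norm_atTop, eventually_comap, eventually_atTop]
  obtain ⟨M, hM⟩ := h ε hε
  refine ⟨M, fun b hb x hx => ?_⟩
  rw [dist_zero_right]
  exact hM x (by rwa [← Real.norm_eq_abs, hx])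

theorem exists_bound (hf : IsVanishing f) : ∃ C : ℝ, ∀ x, ‖f x‖ ≤ C := by
  obtain ⟨M, hM⟩ := hf.exists_norm_lt one_pos
  obtain ⟨C, hC⟩ := (isCompact_Icc (a := -M) (b := M)).exists_bound_of_continuousOn
    hf.1.continuousOn
  refine ⟨max C 1, fun x => ?_⟩
  rcases le_total M |x| with h | h
  · exact (hM x h).le.trans (le_max_right _ _)
  · exact (hC x (abs_le.1 h)).trans (le_max_left _ _)

theorem mul (hf : IsVanishing f) (hg : IsVanishing g) : IsVanishing fun x => f x * g x := by
  obtain ⟨C, hC⟩ := hf.exists_bound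
  exact hg.bounded_mul hf.1 hC

theorem of_hasCompactSupport (hf : Continuous f) (h : HasCompactSupport f) : IsVanishing f :=
  ⟨hf, h.is_zero_at_infty⟩

end IsVanishing

theorem ofReal_sub_ne_zero {z : ℂ} (hz : z.im ≠ 0) (x : ℝ) : (x : ℂ) - z ≠ 0 := fun h => by
  apply hz
  have := congrArg Complex.im h
  simpa using this

theorem norm_inv_ofReal_sub_le {z : ℂ} (hz : z.im ≠ 0) (x : ℝ) :
    ‖((x : ℂ) - z)⁻¹‖ ≤ |z.im|⁻¹ := by
  rw [norm_inv]
  refine inv_anti₀ (abs_pos.2 hz) ?_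
  simpa using Complex.abs_im_le_norm ((x : ℂ) - z)

theorem continuous_inv_ofReal_sub {z : ℂ} (hz : z.im ≠ 0) :
    Continuous fun x : ℝ => ((x : ℂ) - z)⁻¹ :=
  (Complex.continuous_ofReal.sub continuous_const).inv₀ (ofReal_sub_ne_zero hz)

theorem isVanishing_inv_ofReal_sub {z : ℂ} (hz : z.im ≠ 0) :
    IsVanishing fun x : ℝ => ((x : ℂ) - z)⁻¹ := by
  refine .of_exists_norm_lt (continuous_inv_ofReal_sub hz) fun ε hε =>
    ⟨‖z‖ + 2 * ε⁻¹, fun x hx => ?_⟩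
  have h1 : |x| ≤ ‖(x : ℂ) - z‖ + ‖z‖ := by
    have := norm_add_le ((x : ℂ) - z) z
    simpa using this
  have h2 : 0 < ε⁻¹ := by positivity
  rw [norm_inv]
  exact inv_lt_of_inv_lt₀ hε (by linarith)

/-- The tent function that equals `1` on `[-k, k]` and vanishes outside `[-k-1, k+1]`. -/
def cutoff (k : ℕ) (x : ℝ) : ℝ := max 0 (min 1 (k + 1 - |x|))

theorem continuous_cutoff (k : ℕ) : Continuous (cutoff k) := by
  unfold cutoff
  fun_prop

theorem cutoff_nonneg (k : ℕ) (x : ℝ) : 0 ≤ cutoff k x := le_max_left _ _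

theorem cutoff_le_one (k : ℕ) (x : ℝ) : cutoff k x ≤ 1 := max_le zero_le_one (min_le_left _ _)

theorem norm_cutoff_le (k : ℕ) (x : ℝ) : ‖(cutoff k x : ℂ)‖ ≤ 1 := by
  rw [Complex.norm_real, Real.norm_of_nonneg (cutoff_nonneg k x)]
  exact cutoff_le_one k x

theorem cutoff_eq_one {k : ℕ} {x : ℝ} (h : |x| ≤ k) : cutoff k x = 1 := by
  rw [cutoff, min_eq_left (by linarith), max_eq_right zero_le_one]

theorem hasCompactSupport_cutoff (k : ℕ) : HasCompactSupport (cutoff k) := by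
  refine HasCompactSupport.intro (isCompact_Icc (a := -((k : ℝ) + 1)) (b := k + 1)) fun x hx => ?_
  have : (k : ℝ) + 1 < |x| := by
    by_contra! h
    exact hx (abs_le.1 h)
  exact max_eq_left ((min_le_right _ _).trans (by linarith))

theorem isVanishing_cutoff (k : ℕ) : IsVanishing fun x => (cutoff k x : ℂ) :=
  .of_hasCompactSupport (Complex.continuous_ofReal.comp (continuous_cutoff k))
    ((hasCompactSupport_cutoff k).comp_left (g := Complex.ofReal) Complex.ofReal_zero)

theorem tendsto_cutoff (x : ℝ) : Tendsto (fun k => cutoff k x) atTop (𝓝 1) := by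
  obtain ⟨N, hN⟩ := exists_nat_ge |x|
  refine tendsto_const_nhds.congr' ?_
  filter_upwards [eventually_ge_atTop N] with k hk
  exact (cutoff_eq_one (hN.trans (by exact_mod_cast hk))).symm

theorem IsVanishing.eventually_norm_cutoff_mul_sub_le {f : ℝ → ℂ} (hf : IsVanishing f) {ε : ℝ}
    (hε : 0 < ε) : ∀ᶠ k in atTop, ∀ x, ‖(cutoff k x : ℂ) * f x - f x‖ ≤ ε := by
  obtain ⟨M, hM⟩ := hf.exists_norm_lt hε
  obtain ⟨N, hN⟩ := exists_nat_ge M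
  filter_upwards [eventually_ge_atTop N] with k hk x
  rcases le_total M |x| with h | h
  · have h1 : (cutoff k x : ℂ) * f x - f x = ((cutoff k x - 1 : ℝ) : ℂ) * f x := by
      push_cast
      ring
    rw [h1, norm_mul, Complex.norm_real, Real.norm_eq_abs]
    have h2 : |cutoff k x - 1| ≤ 1 :=
      abs_le.2 ⟨by linarith [cutoff_nonneg k x], by linarith [cutoff_le_one k x]⟩
    calc |cutoff k x - 1| * ‖f x‖ ≤ 1 * ‖f x‖ := by gcongr
      _ ≤ ε := by rw [one_mul]; exact (hM x h).le
  · have : cutoff k x = 1 := cutoff_eq_one (h.trans (hN.trans (by exact_mod_cast hk)))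
    simp [this, hε.le]

/-! ### The extended line as a circle -/

/-- The circle onto which `x ↦ (x - i)⁻¹` maps the extended real line. -/
def resolventCircle : Set ℂ := {y | ‖y‖ ^ 2 = y.im}

theorem isCompact_resolventCircle : IsCompact resolventCircle := by
  refine Metric.isCompact_of_isClosed_isBounded ?_ ?_
  · exact isClosed_eq (by fun_prop) Complex.continuous_im
  · refine (Metric.isBounded_closedBall (x := (0 : ℂ)) (r := 1)).subset fun y hy => ?_
    rw [mem_closedBall_zero_iff]
    have h1 : ‖y‖ ^ 2 ≤ ‖y‖ := hy.trans_le ((le_abs_self _).trans (Complex.abs_im_le_norm y))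
    by_contra! h
    nlinarith

/-- That is, `y⁻¹ = x - i` with `x` real, so `y ↦ (y⁻¹).re` inverts the parametrisation. -/
theorem im_inv_of_mem_resolventCircle {y : ℂ} (hy : y ∈ resolventCircle) (h0 : y ≠ 0) :
    (y⁻¹).im = -1 := by
  have h : Complex.normSq y = y.im := by rw [Complex.normSq_eq_norm_sq]; exact hy
  have h1 : Complex.normSq y ≠ 0 := by simpa using h0
  rw [Complex.inv_im, ← h, neg_div, div_self h1]

open Classical in
/-- A function on the line transported to the circle by `x = y⁻¹ + i`, with value `0` at `y = 0`. -/
def resolventPullback (f : ℝ → ℂ) (y : ℂ) : ℂ := if y = 0 then 0 else f (y⁻¹).re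

theorem IsVanishing.continuousOn_resolventPullback {f : ℝ → ℂ} (hf : IsVanishing f) :
    ContinuousOn (resolventPullback f) resolventCircle := by
  intro y hy
  by_cases h0 : y = 0
  · subst h0
    rw [ContinuousWithinAt, Metric.tendsto_nhdsWithin_nhds]
    intro ε hε
    obtain ⟨M, hM⟩ := hf.exists_norm_lt hε
    refine ⟨(|M| + 1)⁻¹, by positivity, fun y hy hd => ?_⟩
    rw [dist_zero_right] at hd
    by_cases h0 : y = 0
    · simpa [resolventPullback, h0] using hε
    · simp only [resolventPullback, if_neg h0, if_true, dist_zero_right]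
      apply hM
      -- Since `Im y⁻¹ = -1`, a small `y` on the circle forces `|Re y⁻¹|` to be large, where `f` is
      -- small.
      have h1 : |M| + 1 < ‖y⁻¹‖ := by
        rw [norm_inv]
        exact lt_inv_of_lt_inv₀ (norm_pos_iff.2 h0) hd
      have h2 := Complex.norm_le_abs_re_add_abs_im y⁻¹
      rw [im_inv_of_mem_resolventCircle hy h0, abs_neg, abs_one] at h2
      linarith [le_abs_self M]
  · have h1 : ContinuousAt (fun y : ℂ => f (y⁻¹).re) y :=
      hf.1.continuousAt.comp (Complex.continuous_re.continuousAt.comp (continuousAt_inv₀ h0))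
    refine (h1.congr ?_).continuousWithinAt
    filter_upwards [isOpen_ne.mem_nhds h0] with w hw
    exact (if_neg hw).symm

theorem norm_resolventPullback_le {f : ℝ → ℂ} {C : ℝ} (h0 : 0 ≤ C) (hC : ∀ x, ‖f x‖ ≤ C) (y : ℂ) :
    ‖resolventPullback f y‖ ≤ C := by
  unfold resolventPullback
  split_ifs
  · simpa using h0
  · exact hC _

theorem resolventPullback_inv_sub_I {y : ℂ} (hy : y ∈ resolventCircle) :
    resolventPullback (fun x : ℝ => ((x : ℂ) - Complex.I)⁻¹) y = y := by
  by_cases h0 : y = 0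
  · simp [resolventPullback, h0]
  · have : (((y⁻¹).re : ℂ) - Complex.I) = y⁻¹ := by
      apply Complex.ext
      · simp
      · rw [im_inv_of_mem_resolventCircle hy h0]
        simp
    simp only [resolventPullback, if_neg h0]
    rw [this, inv_inv]

/-! ### Convergence of bounded sequences of operators from a dense set -/

section Density

variable {𝕜 E F : Type*} [NontriviallyNormedField 𝕜] [NormedAddCommGroup E] [NormedSpace 𝕜 E]
  [NormedAddCommGroup F] [NormedSpace 𝕜 F]

theorem tendsto_norm_zero_of_dense {G : ℕ → Type*} [∀ n, NormedAddCommGroup (G n)]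
    [∀ n, NormedSpace 𝕜 (G n)] {B : ∀ n, E →L[𝕜] G n} {C : ℝ} (hB : ∀ n, ‖B n‖ ≤ C) {S : Set E}
    (hS : Dense S) (h : ∀ x ∈ S, Tendsto (fun n => ‖B n x‖) atTop (𝓝 0)) (x : E) :
    Tendsto (fun n => ‖B n x‖) atTop (𝓝 0) := by
  have hC : 0 ≤ C := (norm_nonneg _).trans (hB 0)
  rw [Metric.tendsto_atTop]
  intro ε hε
  obtain ⟨y, hy, hxy⟩ := hS.exists_dist_lt x (show 0 < ε / (2 * (C + 1)) by positivity)
  obtain ⟨N, hN⟩ := Metric.tendsto_atTop.1 (h y hy) (ε / 2) (by positivity)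
  refine ⟨N, fun n hn => ?_⟩
  have h1 := hN n hn
  rw [dist_zero_right, norm_norm] at h1 ⊢
  have h2 : ‖B n (x - y)‖ ≤ (C + 1) * (ε / (2 * (C + 1))) := by
    refine ((B n).le_opNorm _).trans ?_
    rw [dist_eq_norm] at hxy
    have := hB n
    gcongr
    linarith
  have h3 : (C + 1) * (ε / (2 * (C + 1))) = ε / 2 := by field_simp
  calc ‖B n x‖ = ‖B n (x - y) + B n y‖ := by rw [← map_add, sub_add_cancel]
    _ ≤ ‖B n (x - y)‖ + ‖B n y‖ := norm_add_le _ _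
    _ < ε := by linarith

theorem cauchySeq_of_dense {B : ℕ → E →L[𝕜] F} {C : ℝ} (hB : ∀ n, ‖B n‖ ≤ C) {S : Set E}
    (hS : Dense S) (h : ∀ x ∈ S, CauchySeq fun n => B n x) (x : E) :
    CauchySeq fun n => B n x := by
  have hC : 0 ≤ C := (norm_nonneg _).trans (hB 0)
  rw [Metric.cauchySeq_iff']
  intro ε hε
  obtain ⟨y, hy, hxy⟩ := hS.exists_dist_lt x (show 0 < ε / (4 * (C + 1)) by positivity)
  obtain ⟨N, hN⟩ := Metric.cauchySeq_iff'.1 (h y hy) (ε / 2) (by positivity)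
  refine ⟨N, fun n hn => ?_⟩
  have h1 := hN n hn
  have h2 : ∀ m, dist (B m x) (B m y) ≤ ε / 4 := fun m => by
    rw [dist_eq_norm, ← map_sub]
    refine ((B m).le_opNorm _).trans ?_
    rw [dist_eq_norm] at hxy
    have := hB m
    calc ‖B m‖ * ‖x - y‖ ≤ (C + 1) * (ε / (4 * (C + 1))) := by gcongr; linarith
      _ = ε / 4 := by field_simp
  have h3 := dist_triangle4 (B n x) (B n y) (B N y) (B N x)
  have h4 := h2 N
  rw [dist_comm] at h4
  linarith [h2 n]

end Density

/-! ### Functional calculus through the resolvent at `i` -/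

namespace LinearPMap

variable {H : Type*} [NormedAddCommGroup H] [InnerProductSpace ℂ H] [CompleteSpace H]
variable {A : H →ₗ.[ℂ] H} {f g : ℝ → ℂ}

/-- The resolvent identity between `-i` and `i` reads `R* R = (-2i)⁻¹ (R* - R)`. Both sides are
continuous functions of the normal operator `R`, so they agree on its spectrum: `|y|² = Im y`. -/
theorem spectrum_resolvent_subset (hA : IsSelfAdjoint A) :
    _root_.spectrum ℂ (A.resolvent Complex.I) ⊆ resolventCircle := by
  have hI : Complex.I.im ≠ 0 := by simp
  have hI' : (star Complex.I).im ≠ 0 := by simp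
  have hn := isStarNormal_resolvent hA hI
  set R := A.resolvent Complex.I with hR
  have h1 : star R * R = (-2 * Complex.I)⁻¹ • (star R - R) := by
    rw [ContinuousLinearMap.star_eq_adjoint, hR, adjoint_resolvent hA hI,
      resolvent_sub_resolvent (hA.mem_resolventSet hI') (hA.mem_resolventSet hI), smul_smul]
    have : (-2 * Complex.I)⁻¹ * (star Complex.I - Complex.I) = 1 := by
      have : star Complex.I - Complex.I = -2 * Complex.I := by
        simp
        ring
      rw [this]
      exact inv_mul_cancel₀ (by simp)
    rw [this, one_smul]
    rfl
  have h2 : cfc (fun y : ℂ => star y * y) R = star R * R := by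
    rw [cfc_mul (fun y : ℂ => star y) (fun y => y) R, cfc_star_id R, cfc_id' ℂ R]
  have h3 : cfc (fun y : ℂ => (-2 * Complex.I)⁻¹ • (star y - y)) R =
      (-2 * Complex.I)⁻¹ • (star R - R) := by
    rw [cfc_smul _ (fun y : ℂ => star y - y) R,
      cfc_sub (fun y : ℂ => star y) (fun y => y) R, cfc_star_id R, cfc_id' ℂ R]
  rw [← h2, ← h3] at h1
  intro y hy
  have h4 := (cfc_eq_cfc_iff_eqOn (a := R)).1 h1 hy
  simp only [smul_eq_mul] at h4
  have h5 : star y - y = -2 * Complex.I * y.im := by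
    apply Complex.ext <;> simp
    ring
  rw [h5, inv_mul_cancel_left₀ (by simp), Complex.star_def, ← Complex.normSq_eq_conj_mul_self,
    Complex.normSq_eq_norm_sq] at h4
  exact_mod_cast h4

/-- `f(A)` for a self-adjoint operator `A` and a continuous function `f` vanishing at infinity. -/
def vanishingCalculus (A : H →ₗ.[ℂ] H) (f : ℝ → ℂ) : H →L[ℂ] H :=
  cfc (resolventPullback f) (A.resolvent Complex.I)

theorem continuousOn_resolventPullback_spectrum (hA : IsSelfAdjoint A) (hf : IsVanishing f) :
    ContinuousOn (resolventPullback f) (_root_.spectrum ℂ (A.resolvent Complex.I)) :=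
  hf.continuousOn_resolventPullback.mono (spectrum_resolvent_subset hA)

theorem vanishingCalculus_mul (hA : IsSelfAdjoint A) (hf : IsVanishing f) (hg : IsVanishing g) :
    A.vanishingCalculus (fun x => f x * g x) = A.vanishingCalculus f * A.vanishingCalculus g := by
  have hn := isStarNormal_resolvent hA (z := Complex.I) (by simp)
  have hf' := continuousOn_resolventPullback_spectrum hA hf
  have hg' := continuousOn_resolventPullback_spectrum hA hg
  rw [vanishingCalculus, vanishingCalculus, vanishingCalculus, ← cfc_mul _ _ _ hf' hg']
  refine cfc_congr fun y _ => ?_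
  by_cases h : y = 0 <;> simp [resolventPullback, h]

theorem vanishingCalculus_add (hA : IsSelfAdjoint A) (hf : IsVanishing f) (hg : IsVanishing g) :
    A.vanishingCalculus (fun x => f x + g x) = A.vanishingCalculus f + A.vanishingCalculus g := by
  have hn := isStarNormal_resolvent hA (z := Complex.I) (by simp)
  have hf' := continuousOn_resolventPullback_spectrum hA hf
  have hg' := continuousOn_resolventPullback_spectrum hA hg
  rw [vanishingCalculus, vanishingCalculus, vanishingCalculus, ← cfc_add _ _ _ hf' hg']
  refine cfc_congr fun y _ => ?_
  by_cases h : y = 0 <;> simp [resolventPullback, h]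

theorem vanishingCalculus_const_mul (hA : IsSelfAdjoint A) (hf : IsVanishing f) (c : ℂ) :
    A.vanishingCalculus (fun x => c * f x) = c • A.vanishingCalculus f := by
  have hn := isStarNormal_resolvent hA (z := Complex.I) (by simp)
  have hf' := continuousOn_resolventPullback_spectrum hA hf
  rw [vanishingCalculus, vanishingCalculus, ← cfc_const_mul _ _ _ hf']
  refine cfc_congr fun y _ => ?_
  by_cases h : y = 0 <;> simp [resolventPullback, h]

theorem vanishingCalculus_sub (hA : IsSelfAdjoint A) (hf : IsVanishing f) (hg : IsVanishing g) :
    A.vanishingCalculus (fun x => f x - g x) = A.vanishingCalculus f - A.vanishingCalculus g := by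
  have h := vanishingCalculus_add hA hf (hg.const_mul (-1))
  rw [vanishingCalculus_const_mul hA hg, neg_one_smul, ← sub_eq_add_neg] at h
  rw [← h]
  simp [sub_eq_add_neg]

theorem vanishingCalculus_star (A : H →ₗ.[ℂ] H) (f : ℝ → ℂ) :
    A.vanishingCalculus (fun x => star (f x)) = star (A.vanishingCalculus f) := by
  rw [vanishingCalculus, vanishingCalculus, ← cfc_star]
  refine cfc_congr fun y _ => ?_
  by_cases h : y = 0 <;> simp [resolventPullback, h]

theorem norm_vanishingCalculus_le (A : H →ₗ.[ℂ] H) {C : ℝ} (hC : ∀ x, ‖f x‖ ≤ C) :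
    ‖A.vanishingCalculus f‖ ≤ C := by
  have h0 : 0 ≤ C := (norm_nonneg _).trans (hC 0)
  exact norm_cfc_le h0 fun y _ => norm_resolventPullback_le h0 hC y

/-- At `z = i` the function is the identity on the circle. In general `S`, the left side, and `Q =
R_A(z)` both solve `X (1 - (z - i) R) = R` with `R = R_A(i)`, and `1 - (z - i) R` has the right
inverse `1 + (z - i) Q`. -/
theorem vanishingCalculus_inv_sub (hA : IsSelfAdjoint A) {z : ℂ} (hz : z.im ≠ 0) :
    A.vanishingCalculus (fun x => ((x : ℂ) - z)⁻¹) = A.resolvent z := by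
  have hI : Complex.I.im ≠ 0 := by simp
  have hn := isStarNormal_resolvent hA hI
  have h1 : A.vanishingCalculus (fun x => ((x : ℂ) - Complex.I)⁻¹) = A.resolvent Complex.I := by
    conv_rhs => rw [← cfc_id' ℂ (A.resolvent Complex.I)]
    exact cfc_congr fun y hy => resolventPullback_inv_sub_I (spectrum_resolvent_subset hA hy)
  have hvz := isVanishing_inv_ofReal_sub hz
  have hvI := isVanishing_inv_ofReal_sub hI
  have h2 : (fun x : ℝ => ((x : ℂ) - z)⁻¹ - ((x : ℂ) - Complex.I)⁻¹) =
      fun x : ℝ => (z - Complex.I) * (((x : ℂ) - z)⁻¹ * ((x : ℂ) - Complex.I)⁻¹) := by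
    funext x
    have := ofReal_sub_ne_zero hz x
    have := ofReal_sub_ne_zero hI x
    field_simp
    ring
  have h3 := vanishingCalculus_sub hA hvz hvI
  rw [h2, vanishingCalculus_const_mul hA (hvz.mul hvI), vanishingCalculus_mul hA hvz hvI, h1] at h3
  have h4 := resolvent_sub_resolvent (hA.mem_resolventSet hI) (hA.mem_resolventSet hz)
  have h5 := resolvent_sub_resolvent (hA.mem_resolventSet hz) (hA.mem_resolventSet hI)
  simp only [← ContinuousLinearMap.mul_def] at h4 h5
  set S := A.vanishingCalculus (fun x => ((x : ℂ) - z)⁻¹)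
  set R := A.resolvent Complex.I
  set Q := A.resolvent z
  have h6 : R = S - (z - Complex.I) • (S * R) := by rw [h3]; abel
  have h7 : R = Q - (z - Complex.I) • (Q * R) := by rw [← h5]; abel
  have h8 : (1 - (z - Complex.I) • R) * (1 + (z - Complex.I) • Q) = 1 := by
    have : (1 - (z - Complex.I) • R) * (1 + (z - Complex.I) • Q) =
        1 - (z - Complex.I) • ((R - Q) + (z - Complex.I) • (R * Q)) := by
      simp only [mul_add, sub_mul, mul_one, one_mul, smul_mul_smul_comm, smul_add, smul_sub,
        smul_smul]
      abel
    rw [this, h4, ← add_smul]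
    simp
  calc S = S * ((1 - (z - Complex.I) • R) * (1 + (z - Complex.I) • Q)) := by rw [h8, mul_one]
    _ = (S - (z - Complex.I) • (S * R)) * (1 + (z - Complex.I) • Q) := by
      rw [← mul_assoc, mul_sub, mul_one, mul_smul_comm]
    _ = (Q - (z - Complex.I) • (Q * R)) * (1 + (z - Complex.I) • Q) := by rw [← h6, ← h7]
    _ = Q * ((1 - (z - Complex.I) • R) * (1 + (z - Complex.I) • Q)) := by
      rw [← mul_assoc, mul_sub, mul_one, mul_smul_comm]
    _ = Q := by rw [h8, mul_one]

/-- A bounded continuous function of a self-adjoint operator, as a strong limit. -/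
theorem exists_boundedCalculus (hA : IsSelfAdjoint A) (hf : Continuous f) {C : ℝ}
    (hC : ∀ x, ‖f x‖ ≤ C) :
    ∃ T : H →L[ℂ] H, ‖T‖ ≤ C ∧
      (∀ h, IsVanishing h → T * A.vanishingCalculus h = A.vanishingCalculus fun x => f x * h x) ∧
      ∀ ψ, Tendsto (fun k => A.vanishingCalculus (fun x => cutoff k x * f x) ψ) atTop
        (𝓝 (T ψ)) := by
  have h0 : 0 ≤ C := (norm_nonneg _).trans (hC 0)
  have hI : Complex.I.im ≠ 0 := by simp
  have hv : ∀ k, IsVanishing fun x => (cutoff k x : ℂ) * f x := fun k => by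
    simpa only [mul_comm] using (isVanishing_cutoff k).bounded_mul hf hC
  set B : ℕ → H →L[ℂ] H := fun k => A.vanishingCalculus fun x => cutoff k x * f x with hBdef
  have hB : ∀ k, ‖B k‖ ≤ C := fun k => norm_vanishingCalculus_le A fun x => by
    rw [norm_mul]
    exact (mul_le_mul (norm_cutoff_le k x) (hC x) (norm_nonneg _) zero_le_one).trans_eq (one_mul C)
  -- Applied after `h(A)`, the truncations converge in norm, since `cutoff k * (f * h)` tends to `f
  -- * h` uniformly. With `h = (x - i)⁻¹` this covers a dense set of vectors, and the bound `C` does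
  -- the rest.
  have hlim : ∀ h, IsVanishing h → ∀ φ, Tendsto (fun k => B k (A.vanishingCalculus h φ)) atTop
      (𝓝 (A.vanishingCalculus (fun x => f x * h x) φ)) := fun h hh φ => by
    have hfh := hh.bounded_mul hf hC
    have : Tendsto (fun k => B k * A.vanishingCalculus h) atTop
        (𝓝 (A.vanishingCalculus fun x => f x * h x)) := by
      rw [Metric.tendsto_atTop]
      intro ε hε
      obtain ⟨N, hN⟩ := eventually_atTop.1
        (hfh.eventually_norm_cutoff_mul_sub_le (half_pos hε))
      refine ⟨N, fun k hk => ?_⟩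
      have h1 : B k * A.vanishingCalculus h - A.vanishingCalculus (fun x => f x * h x) =
          A.vanishingCalculus fun x => cutoff k x * (f x * h x) - f x * h x := by
        rw [hBdef, ← vanishingCalculus_mul hA (hv k) hh, ← vanishingCalculus_sub hA
          ((hv k).mul hh) hfh]
        simp only [mul_assoc]
      rw [dist_eq_norm, h1]
      exact (norm_vanishingCalculus_le A (hN k hk)).trans_lt (half_lt_self hε)
    exact ((ContinuousLinearMap.apply ℂ H φ).continuous.tendsto _).comp this
  have hdense := dense_range_resolvent hA hI
  have hres := vanishingCalculus_inv_sub hA hI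
  have hcauchy : ∀ ψ, CauchySeq fun k => B k ψ := by
    refine cauchySeq_of_dense hB hdense ?_
    rintro _ ⟨φ, rfl⟩
    rw [← hres]
    exact (hlim _ (isVanishing_inv_ofReal_sub hI) φ).cauchySeq
  choose t ht using fun ψ => cauchySeq_tendsto_of_complete (hcauchy ψ)
  let T : H →L[ℂ] H := LinearMap.mkContinuous
    { toFun := t
      map_add' := fun x y => tendsto_nhds_unique (ht (x + y)) <| by
        simpa only [_root_.map_add] using (ht x).add (ht y)
      map_smul' := fun c x => tendsto_nhds_unique (ht (c • x)) <| by
        simpa only [_root_.map_smul, RingHom.id_apply] using (ht x).const_smul c } C fun ψ =>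
    le_of_tendsto (ht ψ).norm (.of_forall fun k =>
      ((B k).le_opNorm ψ).trans (mul_le_mul_of_nonneg_right (hB k) (norm_nonneg _)))
  refine ⟨T, LinearMap.mkContinuous_norm_le _ h0 _, fun h hh => ?_, ht⟩
  ext φ
  exact tendsto_nhds_unique (ht _) (hlim h hh φ)

end LinearPMap

/-! ### Injectivity of the Borel transform -/

section Uniqueness

open BoundedContinuousFunction

/-- The bounded continuous function `x ↦ (x - z)⁻¹` for non-real `z`. -/
def stieltjesKernel (z : {z : ℂ // z.im ≠ 0}) : ℝ →ᵇ ℂ :=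
  .ofNormedAddCommGroup (fun x : ℝ => ((x : ℂ) - z)⁻¹) (continuous_inv_ofReal_sub z.2) |z.1.im|⁻¹
    (norm_inv_ofReal_sub_le z.2)

@[simp]
theorem stieltjesKernel_apply (z : {z : ℂ // z.im ≠ 0}) (x : ℝ) :
    stieltjesKernel z x = ((x : ℂ) - z)⁻¹ := rfl

theorem norm_stieltjesKernel_le (z : {z : ℂ // z.im ≠ 0}) : ‖stieltjesKernel z‖ ≤ |z.1.im|⁻¹ :=
  norm_ofNormedAddCommGroup_le _ (by positivity) _

theorem stieltjesKernel_sub (z w : {z : ℂ // z.im ≠ 0}) :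
    stieltjesKernel z - stieltjesKernel w =
      (z.1 - w.1) • (stieltjesKernel z * stieltjesKernel w) := by
  ext x
  have := ofReal_sub_ne_zero z.2 x
  have := ofReal_sub_ne_zero w.2 x
  simp
  field_simp
  ring

/-- The closed linear span of the constants and the functions `x ↦ (x - z)⁻¹`. -/
def stieltjesSpan : Submodule ℂ (ℝ →ᵇ ℂ) :=
  (Submodule.span ℂ ({1} ∪ Set.range stieltjesKernel)).topologicalClosure

theorem one_mem_stieltjesSpan : 1 ∈ stieltjesSpan :=
  Submodule.le_topologicalClosure _ (Submodule.subset_span (by simp))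

theorem stieltjesKernel_mem_stieltjesSpan (z : {z : ℂ // z.im ≠ 0}) :
    stieltjesKernel z ∈ stieltjesSpan :=
  Submodule.le_topologicalClosure _ (Submodule.subset_span (by simp))

theorem isClosed_stieltjesSpan : IsClosed (stieltjesSpan : Set (ℝ →ᵇ ℂ)) :=
  Submodule.isClosed_topologicalClosure _

theorem stieltjesKernel_mul_mem_of_ne {z w : {z : ℂ // z.im ≠ 0}} (h : z ≠ w) :
    stieltjesKernel z * stieltjesKernel w ∈ stieltjesSpan := by
  have h1 : z.1 - w.1 ≠ 0 := sub_ne_zero.2 fun e => h (Subtype.ext e)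
  rw [← inv_smul_smul₀ h1 (stieltjesKernel z * stieltjesKernel w), ← stieltjesKernel_sub]
  exact Submodule.smul_mem _ _ (Submodule.sub_mem _ (stieltjesKernel_mem_stieltjesSpan z)
    (stieltjesKernel_mem_stieltjesSpan w))

/-- For distinct poles this is the partial fraction decomposition. A square is a uniform limit of
products with distinct poles, which is why the span has to be closed. -/
theorem stieltjesKernel_mul_mem (z w : {z : ℂ // z.im ≠ 0}) :
    stieltjesKernel z * stieltjesKernel w ∈ stieltjesSpan := by
  rcases ne_or_eq z w with h | rfl
  · exact stieltjesKernel_mul_mem_of_ne h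
  have him : ∀ n : ℕ, (z.1 + (z.1.im * (1 / ((n : ℝ) + 1)) : ℝ) * Complex.I).im =
      z.1.im * (1 + 1 / ((n : ℝ) + 1)) := fun n => by
    rw [Complex.add_im, Complex.im_ofReal_mul, Complex.I_im]
    ring
  have hpos : ∀ n : ℕ, 0 < 1 / ((n : ℝ) + 1) := fun n => by positivity
  -- The poles approach `z` from the side away from the real axis, so the bound `|Im z|⁻¹` serves
  -- all of them.
  let w : ℕ → {z : ℂ // z.im ≠ 0} := fun n =>
    ⟨z.1 + (z.1.im * (1 / ((n : ℝ) + 1)) : ℝ) * Complex.I, by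
      rw [him n]
      exact mul_ne_zero z.2 (by linarith [hpos n])⟩
  have hsub : ∀ n, (w n).1 - z.1 = (z.1.im * (1 / ((n : ℝ) + 1)) : ℝ) * Complex.I := fun n =>
    add_sub_cancel_left _ _
  have hne : ∀ n, w n ≠ z := fun n h => by
    have h1 := hsub n
    rw [h, sub_self] at h1
    have h2 := congrArg Complex.im h1
    rw [Complex.im_ofReal_mul, Complex.I_im, Complex.zero_im, mul_one] at h2
    exact mul_ne_zero z.2 (hpos n).ne' h2.symm
  have hw : ∀ n, |z.1.im| ≤ |(w n).1.im| := fun n => by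
    have : (w n).1.im = z.1.im * (1 + 1 / ((n : ℝ) + 1)) := him n
    rw [this, abs_mul]
    refine le_mul_of_one_le_right (abs_nonneg _) ?_
    rw [abs_of_pos (by linarith [hpos n])]
    linarith [hpos n]
  have hz0 : 0 < |z.1.im| := abs_pos.2 z.2
  have hlim : Tendsto (fun n => stieltjesKernel (w n)) atTop (𝓝 (stieltjesKernel z)) := by
    rw [tendsto_iff_norm_sub_tendsto_zero]
    refine squeeze_zero (g := fun n : ℕ => |z.1.im|⁻¹ * (1 / ((n : ℝ) + 1)))
      (fun _ => norm_nonneg _) (fun n => ?_) ?_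
    · rw [stieltjesKernel_sub, norm_smul, hsub, norm_mul, Complex.norm_I, mul_one,
        Complex.norm_real, Real.norm_eq_abs, abs_mul, abs_of_pos (hpos n)]
      have h1 : ‖stieltjesKernel (w n) * stieltjesKernel z‖ ≤ |z.1.im|⁻¹ * |z.1.im|⁻¹ := by
        refine (norm_mul_le _ _).trans (mul_le_mul ?_ (norm_stieltjesKernel_le z)
          (norm_nonneg _) (by positivity))
        exact (norm_stieltjesKernel_le _).trans (inv_anti₀ hz0 (hw n))
      calc |z.1.im| * (1 / ((n : ℝ) + 1)) * ‖stieltjesKernel (w n) * stieltjesKernel z‖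
          ≤ |z.1.im| * (1 / ((n : ℝ) + 1)) * (|z.1.im|⁻¹ * |z.1.im|⁻¹) := by gcongr
        _ = |z.1.im|⁻¹ * (1 / ((n : ℝ) + 1)) := by field_simp
    · simpa using (tendsto_one_div_add_atTop_nhds_zero_nat (𝕜 := ℝ)).const_mul |z.1.im|⁻¹
  refine isClosed_stieltjesSpan.mem_of_tendsto (hlim.mul_const _) (.of_forall fun n => ?_)
  exact stieltjesKernel_mul_mem_of_ne (hne n)

theorem mul_mem_stieltjesSpan {f g : ℝ →ᵇ ℂ} (hf : f ∈ stieltjesSpan) (hg : g ∈ stieltjesSpan) :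
    f * g ∈ stieltjesSpan := by
  have key : f * g ∈ closure (stieltjesSpan : Set (ℝ →ᵇ ℂ)) := by
    refine map_mem_closure₂ continuous_mul hf hg fun a ha b hb => ?_
    induction ha using Submodule.span_induction with
    | zero => rw [zero_mul]; exact zero_mem _
    | add x y _ _ hx hy => rw [add_mul]; exact add_mem hx hy
    | smul c x _ hx => rw [smul_mul_assoc]; exact Submodule.smul_mem _ _ hx
    | mem x hx =>
      induction hb using Submodule.span_induction with
      | zero => rw [mul_zero]; exact zero_mem _
      | add u v _ _ hu hv => rw [mul_add]; exact add_mem hu hv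
      | smul c u _ hu => rw [mul_smul_comm]; exact Submodule.smul_mem _ _ hu
      | mem y hy =>
        rcases hx with rfl | ⟨z, rfl⟩
        · rw [one_mul]
          exact Submodule.le_topologicalClosure _ (Submodule.subset_span hy)
        · rcases hy with rfl | ⟨w, rfl⟩
          · rw [mul_one]
            exact stieltjesKernel_mem_stieltjesSpan z
          · exact stieltjesKernel_mul_mem z w
  rwa [isClosed_stieltjesSpan.closure_eq] at key

theorem star_mem_stieltjesSpan {f : ℝ →ᵇ ℂ} (hf : f ∈ stieltjesSpan) : star f ∈ stieltjesSpan := by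
  have key : star f ∈ closure (stieltjesSpan : Set (ℝ →ᵇ ℂ)) := by
    refine map_mem_closure continuous_star hf fun a ha => ?_
    induction ha using Submodule.span_induction with
    | zero => rw [star_zero]; exact zero_mem _
    | add x y _ _ hx hy => rw [star_add]; exact add_mem hx hy
    | smul c x _ hx => rw [star_smul]; exact Submodule.smul_mem _ _ hx
    | mem x hx =>
      rcases hx with rfl | ⟨z, rfl⟩
      · rw [star_one]
        exact one_mem_stieltjesSpan
      · have : star (stieltjesKernel z) = stieltjesKernel ⟨star z.1, by simpa using z.2⟩ := by
          ext x
          simp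
        rw [this]
        exact stieltjesKernel_mem_stieltjesSpan _
  rwa [isClosed_stieltjesSpan.closure_eq] at key

/-- The star algebra of functions generated by the functions `x ↦ (x - z)⁻¹`. -/
def stieltjesAlgebra : StarSubalgebra ℂ (ℝ →ᵇ ℂ) where
  carrier := stieltjesSpan
  mul_mem' := mul_mem_stieltjesSpan
  add_mem' := add_mem
  algebraMap_mem' c := by
    rw [Algebra.algebraMap_eq_smul_one]
    exact Submodule.smul_mem _ _ one_mem_stieltjesSpan
  star_mem' := star_mem_stieltjesSpan

variable (μ ν : Measure ℝ) [IsFiniteMeasure μ] [IsFiniteMeasure ν]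

/-- Integration of bounded continuous functions. -/
def integralBounded : (ℝ →ᵇ ℂ) →L[ℂ] ℂ :=
  LinearMap.mkContinuous
    { toFun := fun g => ∫ x, g x ∂μ
      map_add' := fun f g => integral_add (f.integrable μ) (g.integrable μ)
      map_smul' := fun c f => integral_const_mul c f } (μ.real Set.univ) fun g =>
    g.norm_integral_le_mul_norm μ

/-- Recovers the total mass from the Borel transform: `-iy (x - iy)⁻¹ → 1` as `y = n + 1 → ∞`, with
modulus at most `1`. This covers the constants in `stieltjesSpan`. -/
theorem tendsto_stieltjes :
    Tendsto (fun n : ℕ => ∫ x : ℝ, -(((n : ℂ) + 1) * Complex.I) *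
      ((x : ℂ) - ((n : ℂ) + 1) * Complex.I)⁻¹ ∂μ) atTop (𝓝 (∫ _, 1 ∂μ)) := by
  have him : ∀ n : ℕ, (((n : ℂ) + 1) * Complex.I).im = (n : ℝ) + 1 := fun n => by simp
  have hne : ∀ n : ℕ, (((n : ℂ) + 1) * Complex.I).im ≠ 0 := fun n => by
    rw [him]
    positivity
  have hnorm : ∀ n : ℕ, ∀ x : ℝ, ‖((x : ℂ) - ((n : ℂ) + 1) * Complex.I)⁻¹‖ ≤ ((n : ℝ) + 1)⁻¹ :=
    fun n x => by
      have := norm_inv_ofReal_sub_le (hne n) x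
      rwa [him, abs_of_pos (by positivity)] at this
  refine tendsto_integral_of_dominated_convergence (fun _ => 1) (fun n => ?_)
    (integrable_const 1) (fun n => .of_forall fun x => ?_) (.of_forall fun x => ?_)
  · exact (continuous_const.mul (continuous_inv_ofReal_sub (hne n))).aestronglyMeasurable
  · have h1 : ‖-(((n : ℂ) + 1) * Complex.I)‖ = (n : ℝ) + 1 := by
      rw [norm_neg, norm_mul, Complex.norm_I, mul_one]
      exact_mod_cast Complex.norm_of_nonneg (by positivity : (0 : ℝ) ≤ n + 1)
    rw [norm_mul, h1]
    calc ((n : ℝ) + 1) * _ ≤ ((n : ℝ) + 1) * ((n : ℝ) + 1)⁻¹ := by gcongr; exact hnorm n x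
      _ = 1 := mul_inv_cancel₀ (by positivity)
  · rw [tendsto_iff_norm_sub_tendsto_zero]
    refine squeeze_zero (g := fun n : ℕ => |x| * (1 / ((n : ℝ) + 1)))
      (fun _ => norm_nonneg _) (fun n => ?_) ?_
    · have h1 : -(((n : ℂ) + 1) * Complex.I) * ((x : ℂ) - ((n : ℂ) + 1) * Complex.I)⁻¹ - 1 =
          -x * ((x : ℂ) - ((n : ℂ) + 1) * Complex.I)⁻¹ := by
        have := ofReal_sub_ne_zero (hne n) x
        field_simp
        ring
      rw [h1, norm_mul, norm_neg, Complex.norm_real, Real.norm_eq_abs, one_div]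
      gcongr
      exact hnorm n x
    · simpa using (tendsto_one_div_add_atTop_nhds_zero_nat (𝕜 := ℝ)).const_mul |x|

variable {μ ν}

/-- A finite measure on the line is determined by its Borel transform. -/
theorem MeasureTheory.Measure.ext_of_forall_stieltjes_eq
    (h : ∀ z : ℂ, z.im ≠ 0 → ∫ x : ℝ, ((x : ℂ) - z)⁻¹ ∂μ = ∫ x : ℝ, ((x : ℂ) - z)⁻¹ ∂ν) :
    μ = ν := by
  refine ext_of_forall_mem_subalgebra_integral_eq_of_polish (A := stieltjesAlgebra) ?_ ?_
  · intro x y hxy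
    refine ⟨stieltjesKernel ⟨Complex.I, by simp⟩, ⟨_, ⟨stieltjesKernel ⟨Complex.I, by simp⟩,
      stieltjesKernel_mem_stieltjesSpan _, rfl⟩, rfl⟩, fun e => hxy ?_⟩
    simpa using e
  · have h1 : integralBounded μ 1 = integralBounded ν 1 := by
      refine tendsto_nhds_unique (tendsto_stieltjes μ) ((tendsto_stieltjes ν).congr fun n => ?_)
      rw [integral_const_mul, integral_const_mul, h]
      simp
      positivity
    -- Equality of the two integrals is a closed linear condition, so it need only be checked on the
    -- generators.
    have hle : stieltjesSpan ≤ LinearMap.eqLocus (integralBounded μ).toLinearMap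
        (integralBounded ν).toLinearMap := by
      refine Submodule.topologicalClosure_minimal _ (Submodule.span_le.2 ?_)
        (isClosed_eq (integralBounded μ).continuous (integralBounded ν).continuous)
      rintro _ (rfl | ⟨z, rfl⟩)
      · exact h1
      · exact h z z.2
    exact fun g hg => hle hg

end Uniqueness

/-! ### Spectral measures and the bounded continuous functional calculus -/

namespace LinearPMap

variable {H : Type*} [NormedAddCommGroup H] [InnerProductSpace ℂ H]
variable {A : H →ₗ.[ℂ] H} {f g : ℝ → ℂ} {ψ : H} {μ ν : Measure ℝ}

theorem IsSpectralMeasure.unique (hμ : A.IsSpectralMeasure ψ μ) (hν : A.IsSpectralMeasure ψ ν) :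
    μ = ν := by
  have := hμ.1
  have := hν.1
  exact Measure.ext_of_forall_stieltjes_eq fun z hz => by rw [← hμ.2 z hz, hν.2 z hz]

/-- Both witnesses use the same spectral measure, so the quadratic forms coincide; by polarization
so do the operators. Hence the choice in `functionOf` is harmless. -/
theorem IsFunctionOf.unique {S T : H →L[ℂ] H} (hS : A.IsFunctionOf f S) (hT : A.IsFunctionOf f T) :
    S = T := by
  rw [← ContinuousLinearMap.coe_inj, ← ext_inner_map]
  intro ψ
  obtain ⟨μ, hμ, -, h1⟩ := hS ψ
  obtain ⟨ν, hν, -, h2⟩ := hT ψ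
  obtain rfl := hμ.unique hν
  have h3 : inner ℂ ψ (S ψ) = inner ℂ ψ (T ψ) := h1.trans h2.symm
  have h4 := congrArg (starRingEnd ℂ) h3
  rwa [inner_conj_symm, inner_conj_symm] at h4

theorem IsFunctionOf.functionOf_eq {T : H →L[ℂ] H} (hT : A.IsFunctionOf f T) :
    A.functionOf f = T := by
  have h : ∃ T : H →L[ℂ] H, A.IsFunctionOf f T := ⟨T, hT⟩
  rw [functionOf, dif_pos h]
  exact h.choose_spec.unique hT

variable [CompleteSpace H]

open CompactlySupported

/-- The function is `|√f|²`, so the form equals `‖(√f)(A) ψ‖²`. -/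
theorem re_inner_vanishingCalculus_nonneg (hA : IsSelfAdjoint A) {f : ℝ → ℝ} (hf : Continuous f)
    (hfc : HasCompactSupport f) (h0 : ∀ x, 0 ≤ f x) (ψ : H) :
    0 ≤ (inner ℂ ψ (A.vanishingCalculus (fun x => f x) ψ)).re := by
  have hs : IsVanishing fun x => ((√(f x) : ℝ) : ℂ) :=
    .of_hasCompactSupport (by fun_prop)
      (hfc.comp_left (g := fun y : ℝ => ((√y : ℝ) : ℂ)) (by simp))
  have h1 : (fun x => (f x : ℂ)) = fun x => star ((√(f x) : ℝ) : ℂ) * ((√(f x) : ℝ) : ℂ) := by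
    funext x
    rw [Complex.star_def, Complex.conj_ofReal, ← Complex.ofReal_mul, Real.mul_self_sqrt (h0 x)]
  rw [h1, vanishingCalculus_mul hA hs.star hs, vanishingCalculus_star,
    ContinuousLinearMap.star_eq_adjoint, mul_apply_eq_comp,
    ContinuousLinearMap.adjoint_inner_right]
  exact inner_self_nonneg (𝕜 := ℂ)

/-- The positive functional `f ↦ ⟪ψ, f(A) ψ⟫` on compactly supported functions. -/
def spectralFunctional (hA : IsSelfAdjoint A) (ψ : H) : C_c(ℝ, ℝ) →ₚ[ℝ] ℝ :=
  have hv : ∀ f : C_c(ℝ, ℝ), IsVanishing fun x => (f x : ℂ) := fun f =>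
    .of_hasCompactSupport (Complex.continuous_ofReal.comp f.continuous)
      (f.hasCompactSupport.comp_left (g := Complex.ofReal) Complex.ofReal_zero)
  .mk₀
    { toFun := fun f => (inner ℂ ψ (A.vanishingCalculus (fun x => f x) ψ)).re
      map_add' := fun f g => by
        have := vanishingCalculus_add hA (hv f) (hv g)
        simp only [CompactlySupportedContinuousMap.coe_add, Pi.add_apply, Complex.ofReal_add, this,
          _root_.add_apply, inner_add_right, Complex.add_re]
      map_smul' := fun c f => by
        have := vanishingCalculus_const_mul hA (hv f) c
        simp only [CompactlySupportedContinuousMap.coe_smul, Pi.smul_apply, smul_eq_mul,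
          Complex.ofReal_mul, this, _root_.smul_apply, inner_smul_right, Complex.re_ofReal_mul,
          RingHom.id_apply] }
    fun f hf => re_inner_vanishingCalculus_nonneg hA f.continuous f.hasCompactSupport
      (fun x => hf x) ψ

theorem im_inner_vanishingCalculus (A : H →ₗ.[ℂ] H) (f : ℝ → ℝ) (ψ : H) :
    (inner ℂ ψ (A.vanishingCalculus (fun x => f x) ψ)).im = 0 := by
  have h1 : star (A.vanishingCalculus fun x => (f x : ℂ)) = A.vanishingCalculus fun x => f x := by
    rw [← vanishingCalculus_star]
    simp
  rw [← Complex.conj_eq_iff_im, inner_conj_symm]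
  nth_rw 1 [← h1]
  rw [ContinuousLinearMap.star_eq_adjoint, ContinuousLinearMap.adjoint_inner_left]

/-- Riesz–Markov represents the functional on real functions; real and imaginary parts give the
complex ones. -/
theorem exists_measure_vanishingCalculus (hA : IsSelfAdjoint A) (ψ : H) :
    ∃ μ : Measure ℝ, IsFiniteMeasure μ ∧ ∀ f : ℝ → ℂ, Continuous f → HasCompactSupport f →
      inner ℂ ψ (A.vanishingCalculus f ψ) = ∫ x, f x ∂μ := by
  set μ := RealRMK.rieszMeasure (spectralFunctional hA ψ) with hμ
  have hreal : ∀ f : ℝ → ℝ, Continuous f → HasCompactSupport f →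
      inner ℂ ψ (A.vanishingCalculus (fun x => f x) ψ) = ((∫ x, f x ∂μ : ℝ) : ℂ) :=
    fun f hf hfc => by
      have h1 := RealRMK.integral_rieszMeasure (spectralFunctional hA ψ) ⟨⟨f, hf⟩, hfc⟩
      have h2 : (inner ℂ ψ (A.vanishingCalculus (fun x => f x) ψ)).re = ∫ x, f x ∂μ := h1.symm
      apply Complex.ext
      · rw [h2, Complex.ofReal_re]
      · rw [im_inner_vanishingCalculus, Complex.ofReal_im]
  refine ⟨μ, ⟨?_⟩, fun f hf hfc => ?_⟩
  -- Finiteness of `μ`: the cutoffs have integral at most `‖ψ‖²` and tend to `1`, so Fatou bounds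
  -- the total mass.
  · have hk : ∀ k, ∫⁻ x, ENNReal.ofReal (cutoff k x) ∂μ ≤ ENNReal.ofReal (‖ψ‖ * ‖ψ‖) := fun k => by
      have hint : Integrable (cutoff k) μ :=
        (continuous_cutoff k).integrable_of_hasCompactSupport (hasCompactSupport_cutoff k)
      rw [← ofReal_integral_eq_lintegral_ofReal hint (.of_forall (cutoff_nonneg k))]
      apply ENNReal.ofReal_le_ofReal
      have h1 := congrArg norm (hreal _ (continuous_cutoff k) (hasCompactSupport_cutoff k))
      rw [Complex.norm_real] at h1
      refine (Real.le_norm_self _).trans ?_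
      rw [← h1]
      refine (norm_inner_le_norm _ _).trans ?_
      gcongr
      refine (ContinuousLinearMap.le_opNorm _ _).trans ?_
      have := norm_vanishingCalculus_le A (norm_cutoff_le k)
      calc _ ≤ 1 * ‖ψ‖ := by gcongr
        _ = ‖ψ‖ := one_mul _
    have h2 : ∀ x, liminf (fun k => ENNReal.ofReal (cutoff k x)) atTop = 1 := fun x => by
      have := ENNReal.tendsto_ofReal (tendsto_cutoff x)
      rw [ENNReal.ofReal_one] at this
      exact this.liminf_eq
    calc μ Set.univ = ∫⁻ x, liminf (fun k => ENNReal.ofReal (cutoff k x)) atTop ∂μ := by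
          simp [h2]
      _ ≤ liminf (fun k => ∫⁻ x, ENNReal.ofReal (cutoff k x) ∂μ) atTop :=
          lintegral_liminf_le fun k => (continuous_cutoff k).measurable.ennreal_ofReal
      _ ≤ liminf (fun _ : ℕ => ENNReal.ofReal (‖ψ‖ * ‖ψ‖)) atTop :=
          liminf_le_liminf (.of_forall hk)
      _ < ⊤ := by rw [liminf_const]; exact ENNReal.ofReal_lt_top
  · have hre : Continuous fun x => (f x).re := Complex.continuous_re.comp hf
    have him : Continuous fun x => (f x).im := Complex.continuous_im.comp hf
    have hrec : HasCompactSupport fun x => (f x).re := hfc.comp_left Complex.zero_re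
    have himc : HasCompactSupport fun x => (f x).im := hfc.comp_left Complex.zero_im
    have hvre : IsVanishing fun x => ((f x).re : ℂ) :=
      .of_hasCompactSupport (by fun_prop) (hrec.comp_left (g := Complex.ofReal) rfl)
    have hvim : IsVanishing fun x => ((f x).im : ℂ) :=
      .of_hasCompactSupport (by fun_prop) (himc.comp_left (g := Complex.ofReal) rfl)
    have hsplit : f = fun x => ((f x).re : ℂ) + Complex.I * ((f x).im : ℂ) := by
      funext x
      rw [mul_comm, Complex.re_add_im]
    have hint := integral_re_add_im (μ := μ) (hf.integrable_of_hasCompactSupport hfc)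
    rw [← hint]
    conv_lhs => rw [hsplit]
    rw [vanishingCalculus_add hA hvre (hvim.const_mul _), vanishingCalculus_const_mul hA hvim,
      _root_.add_apply, _root_.smul_apply, inner_add_right, inner_smul_right, hreal _ hre hrec,
      hreal _ him himc, mul_comm]
    rfl

/-- A single measure serves every `f`. Stating it for any `T` that is the limit of the truncations
at `ψ` lets it apply to the resolvents as well, which shows that this measure is the spectral
measure. -/
theorem exists_measure_boundedCalculus (hA : IsSelfAdjoint A) (ψ : H) :
    ∃ μ : Measure ℝ, A.IsSpectralMeasure ψ μ ∧ ∀ f : ℝ → ℂ, Continuous f →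
      ∀ C : ℝ, (∀ x, ‖f x‖ ≤ C) → ∀ T : H →L[ℂ] H,
      Tendsto (fun k => A.vanishingCalculus (fun x => cutoff k x * f x) ψ) atTop (𝓝 (T ψ)) →
      inner ℂ ψ (T ψ) = ∫ x, f x ∂μ := by
  obtain ⟨μ, hμ, h⟩ := exists_measure_vanishingCalculus hA ψ
  have key : ∀ f : ℝ → ℂ, Continuous f → ∀ C : ℝ, (∀ x, ‖f x‖ ≤ C) → ∀ T : H →L[ℂ] H,
      Tendsto (fun k => A.vanishingCalculus (fun x => cutoff k x * f x) ψ) atTop (𝓝 (T ψ)) →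
      inner ℂ ψ (T ψ) = ∫ x, f x ∂μ := fun f hf C hC T hT => by
    have hcont : ∀ k, Continuous fun x => (cutoff k x : ℂ) * f x := fun k =>
      (Complex.continuous_ofReal.comp (continuous_cutoff k)).mul hf
    refine tendsto_nhds_unique ((tendsto_const_nhds (x := ψ)).inner hT) ?_
    have h1 : ∀ k, inner ℂ ψ (A.vanishingCalculus (fun x => cutoff k x * f x) ψ) =
        ∫ x, cutoff k x * f x ∂μ := fun k =>
      h _ (hcont k) (((hasCompactSupport_cutoff k).comp_left (g := Complex.ofReal) rfl).mul_right)
    simp only [h1]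
    refine tendsto_integral_of_dominated_convergence (fun _ => C)
      (fun k => (hcont k).aestronglyMeasurable) (integrable_const C)
      (fun k => .of_forall fun x => ?_) (.of_forall fun x => ?_)
    · rw [norm_mul]
      exact (mul_le_mul (norm_cutoff_le k x) (hC x) (norm_nonneg _) zero_le_one).trans_eq
        (one_mul C)
    · have := ((Complex.continuous_ofReal.tendsto _).comp (tendsto_cutoff x)).mul_const (f x)
      simpa using this
  refine ⟨μ, ⟨hμ, fun z hz => ?_⟩, key⟩
  have hv := isVanishing_inv_ofReal_sub hz
  refine key _ hv.1 _ (norm_inv_ofReal_sub_le hz) _ ?_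
  rw [← vanishingCalculus_inv_sub hA hz]
  have hlim : Tendsto (fun k => A.vanishingCalculus fun x => (cutoff k x : ℂ) * ((x : ℂ) - z)⁻¹)
      atTop (𝓝 (A.vanishingCalculus fun x => ((x : ℂ) - z)⁻¹)) := by
    rw [Metric.tendsto_atTop]
    intro ε hε
    obtain ⟨N, hN⟩ := eventually_atTop.1 (hv.eventually_norm_cutoff_mul_sub_le (half_pos hε))
    refine ⟨N, fun k hk => ?_⟩
    rw [dist_eq_norm, ← vanishingCalculus_sub hA ((isVanishing_cutoff k).mul hv) hv]
    exact (norm_vanishingCalculus_le A (hN k hk)).trans_lt (half_lt_self hε)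
  exact ((ContinuousLinearMap.apply ℂ H ψ).continuous.tendsto _).comp hlim

/-- Every bounded continuous function of a self-adjoint operator is a bounded operator. -/
theorem isFunctionOf_of_tendsto (hA : IsSelfAdjoint A) (hf : Continuous f) {C : ℝ}
    (hC : ∀ x, ‖f x‖ ≤ C) {T : H →L[ℂ] H}
    (hT : ∀ ψ, Tendsto (fun k => A.vanishingCalculus (fun x => cutoff k x * f x) ψ) atTop
      (𝓝 (T ψ))) : A.IsFunctionOf f T := fun ψ => by
  obtain ⟨μ, hμ, h⟩ := exists_measure_boundedCalculus hA ψ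
  have := hμ.1
  exact ⟨μ, hμ, (integrable_const C).mono' hf.aestronglyMeasurable (.of_forall hC),
    h f hf C hC T (hT ψ)⟩

theorem isFunctionOf_functionOf (hA : IsSelfAdjoint A) (hf : Continuous f) {C : ℝ}
    (hC : ∀ x, ‖f x‖ ≤ C) : A.IsFunctionOf f (A.functionOf f) := by
  obtain ⟨T, -, -, hT⟩ := exists_boundedCalculus hA hf hC
  have := isFunctionOf_of_tendsto hA hf hC hT
  rwa [this.functionOf_eq]

theorem norm_functionOf_le (hA : IsSelfAdjoint A) (hf : Continuous f) {C : ℝ}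
    (hC : ∀ x, ‖f x‖ ≤ C) : ‖A.functionOf f‖ ≤ C := by
  obtain ⟨T, h, -, hT⟩ := exists_boundedCalculus hA hf hC
  rwa [(isFunctionOf_of_tendsto hA hf hC hT).functionOf_eq]

theorem functionOf_mul_vanishingCalculus (hA : IsSelfAdjoint A) (hf : Continuous f) {C : ℝ}
    (hC : ∀ x, ‖f x‖ ≤ C) (hg : IsVanishing g) :
    A.functionOf f * A.vanishingCalculus g = A.vanishingCalculus fun x => f x * g x := by
  obtain ⟨T, -, h, hT⟩ := exists_boundedCalculus hA hf hC
  rw [(isFunctionOf_of_tendsto hA hf hC hT).functionOf_eq]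
  exact h g hg

/-- Bounded operators that agree on the dense range of `R_A(i)` are equal. -/
theorem functionOf_eq_of_mul_resolvent_eq (hA : IsSelfAdjoint A) (hf : Continuous f) {C : ℝ}
    (hC : ∀ x, ‖f x‖ ≤ C) {T : H →L[ℂ] H}
    (hT : T * A.resolvent Complex.I =
      A.vanishingCalculus fun x => f x * ((x : ℂ) - Complex.I)⁻¹) : A.functionOf f = T := by
  have hI : Complex.I.im ≠ 0 := by simp
  have h := functionOf_mul_vanishingCalculus hA hf hC (isVanishing_inv_ofReal_sub hI)
  rw [vanishingCalculus_inv_sub hA hI, ← hT] at h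
  have := (dense_range_resolvent hA hI).equalizer (A.functionOf f).continuous T.continuous
    (funext fun ψ => congrArg (fun S : H →L[ℂ] H => S ψ) h)
  exact ContinuousLinearMap.coeFn_injective this

theorem functionOf_eq_vanishingCalculus (hA : IsSelfAdjoint A) (hf : IsVanishing f) :
    A.functionOf f = A.vanishingCalculus f := by
  have hI : Complex.I.im ≠ 0 := by simp
  obtain ⟨C, hC⟩ := hf.exists_bound
  refine functionOf_eq_of_mul_resolvent_eq hA hf.1 hC ?_
  rw [vanishingCalculus_mul hA hf (isVanishing_inv_ofReal_sub hI), vanishingCalculus_inv_sub hA hI]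

theorem functionOf_one (hA : IsSelfAdjoint A) : A.functionOf (fun _ => 1) = 1 := by
  have hI : Complex.I.im ≠ 0 := by simp
  refine functionOf_eq_of_mul_resolvent_eq hA continuous_const (C := 1) (by simp) ?_
  simp only [one_mul]
  exact (vanishingCalculus_inv_sub hA hI).symm

theorem IsSpectralMeasure.inner_functionOf (hA : IsSelfAdjoint A) (hμ : A.IsSpectralMeasure ψ μ)
    (hf : Continuous f) {C : ℝ} (hC : ∀ x, ‖f x‖ ≤ C) :
    inner ℂ ψ (A.functionOf f ψ) = ∫ x, f x ∂μ := by
  obtain ⟨ν, hν, -, h⟩ := isFunctionOf_functionOf hA hf hC ψ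
  rwa [hν.unique hμ] at h

theorem IsSpectralMeasure.inner_vanishingCalculus (hA : IsSelfAdjoint A)
    (hμ : A.IsSpectralMeasure ψ μ) (hf : IsVanishing f) :
    inner ℂ ψ (A.vanishingCalculus f ψ) = ∫ x, f x ∂μ := by
  obtain ⟨C, hC⟩ := hf.exists_bound
  rw [← functionOf_eq_vanishingCalculus hA hf, hμ.inner_functionOf hA hf.1 hC]

/-- Functions that agree almost everywhere for all spectral measures have the same value at `A`. -/
theorem functionOf_congr (hA : IsSelfAdjoint A) (hg : Continuous g) {C : ℝ} (hC : ∀ x, ‖g x‖ ≤ C)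
    (h : ∀ ψ μ, A.IsSpectralMeasure ψ μ → f =ᵐ[μ] g) : A.functionOf f = A.functionOf g := by
  refine IsFunctionOf.functionOf_eq fun ψ => ?_
  obtain ⟨μ, hμ, hi, he⟩ := isFunctionOf_functionOf hA hg hC ψ
  exact ⟨μ, hμ, hi.congr (h ψ μ hμ).symm, he.trans (integral_congr_ae (h ψ μ hμ).symm)⟩

end LinearPMap

/-! ### Operators bounded below and the heat semigroup -/

namespace LinearPMap

variable {H : Type*} [NormedAddCommGroup H] [InnerProductSpace ℂ H] [CompleteSpace H]
variable {A : H →ₗ.[ℂ] H} {ψ : H} {μ : Measure ℝ} {γ : ℝ}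

/-- One factor `(x - i)⁻¹` compensates the linear growth, the other gives decay. -/
theorem isVanishing_max_sub_mul (γ : ℝ) :
    IsVanishing fun x : ℝ => ((max (γ - x) 0 : ℝ) : ℂ) * ((x : ℂ) - Complex.I)⁻¹ *
      ((x : ℂ) - Complex.I)⁻¹ := by
  have hI : Complex.I.im ≠ 0 := by simp
  refine (isVanishing_inv_ofReal_sub hI).bounded_mul (C := |γ| + 1) ?_ fun x => ?_
  · exact (Complex.continuous_ofReal.comp (by fun_prop)).mul (continuous_inv_ofReal_sub hI)
  · have h0 : 0 < ‖(x : ℂ) - Complex.I‖ := norm_pos_iff.2 (ofReal_sub_ne_zero hI x)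
    have h1 : |x| ≤ ‖(x : ℂ) - Complex.I‖ := by
      simpa using Complex.abs_re_le_norm ((x : ℂ) - Complex.I)
    have h2 : 1 ≤ ‖(x : ℂ) - Complex.I‖ := by
      simpa using Complex.abs_im_le_norm ((x : ℂ) - Complex.I)
    rw [norm_mul, norm_inv, Complex.norm_real, Real.norm_of_nonneg (le_max_right _ _),
      ← div_eq_mul_inv, div_le_iff₀ h0]
    refine max_le ?_ (by positivity)
    nlinarith [le_abs_self γ, neg_abs_le x, abs_nonneg γ]

/-- The spectral measures of an operator that is bounded below live on a half-line. -/
theorem IsSpectralMeasure.ae_ge (hA : IsSelfAdjoint A) (hγ : A.IsBoundedBelowBy γ)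
    (hμ : A.IsSpectralMeasure ψ μ) : ∀ᵐ x ∂μ, γ ≤ x := by
  have hI : Complex.I.im ≠ 0 := by simp
  have := hμ.1
  set h : ℝ → ℂ := fun x => ((max (γ - x) 0 : ℝ) : ℂ) * ((x : ℂ) - Complex.I)⁻¹ *
      ((x : ℂ) - Complex.I)⁻¹ with hdef
  have hh : IsVanishing h := isVanishing_max_sub_mul γ
  -- The vector `q(A) ψ = R_A(i) h(A) ψ` lies in the domain, and `q` is non-zero exactly where `x <
  -- γ`. The lower bound there reads `γ ∫ |q|² ≤ ∫ x |q|²`, while `(γ - x)|q|² ≥ 0` pointwise; so `q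
  -- = 0` almost everywhere.
  set q : ℝ → ℂ := fun x => ((x : ℂ) - Complex.I)⁻¹ * h x with qdef
  have hq : IsVanishing q := (isVanishing_inv_ofReal_sub hI).mul hh
  have hxq : ∀ x, h x + Complex.I * q x = x * q x := fun x => by
    have := ofReal_sub_ne_zero hI x
    simp only [qdef]
    field_simp
    ring
  have hvxq : IsVanishing fun x => (x : ℂ) * q x := by
    have := hh.add (hq.const_mul Complex.I)
    simpa only [hxq] using this
  obtain ⟨hu, eu⟩ := (isResolventAt_resolvent (hA.mem_resolventSet hI)).1 (A.vanishingCalculus h ψ)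
  have hqR : A.resolvent Complex.I (A.vanishingCalculus h ψ) = A.vanishingCalculus q ψ := by
    rw [vanishingCalculus_mul hA (isVanishing_inv_ofReal_sub hI) hh, vanishingCalculus_inv_sub hA hI]
    rfl
  have hAu : A ⟨_, hu⟩ = A.vanishingCalculus (fun x => (x : ℂ) * q x) ψ := by
    rw [sub_eq_iff_eq_add.1 eu, hqR]
    simp only [← hxq]
    rw [vanishingCalculus_add hA hh (hq.const_mul _), vanishingCalculus_const_mul hA hq]
    rfl
  have hbelow := hγ ⟨_, hu⟩
  rw [hAu] at hbelow
  simp only [hqR] at hbelow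
  have hinner : ∀ g, IsVanishing g → inner ℂ (A.vanishingCalculus q ψ) (A.vanishingCalculus g ψ) =
      ∫ x, star (q x) * g x ∂μ := fun g hg => by
    rw [← hμ.inner_vanishingCalculus hA (hq.star.mul hg), vanishingCalculus_mul hA hq.star hg,
      vanishingCalculus_star, ContinuousLinearMap.star_eq_adjoint, mul_apply_eq_comp,
      ContinuousLinearMap.adjoint_inner_right]
  have hint : ∀ g, IsVanishing g → Integrable g μ := fun g hg => by
    obtain ⟨C, hC⟩ := hg.exists_bound
    exact (integrable_const C).mono' hg.1.aestronglyMeasurable (.of_forall hC)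
  have hsq : ∀ x, star (q x) * q x = ((‖q x‖ ^ 2 : ℝ) : ℂ) := fun x => by
    rw [Complex.star_def, ← Complex.normSq_eq_conj_mul_self, Complex.normSq_eq_norm_sq]
  have hxsq : ∀ x : ℝ, star (q x) * (x * q x) = ((x * ‖q x‖ ^ 2 : ℝ) : ℂ) := fun x => by
    rw [mul_left_comm, hsq]
    push_cast
    rfl
  have h1 : ‖A.vanishingCalculus q ψ‖ ^ 2 = ∫ x, ‖q x‖ ^ 2 ∂μ := by
    have h2 := hinner q hq
    simp only [hsq] at h2
    rw [integral_complex_ofReal, inner_self_eq_norm_sq_to_K] at h2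
    exact Complex.ofReal_injective ((Complex.ofReal_pow _ _).trans h2)
  have h2 : (inner ℂ (A.vanishingCalculus q ψ)
      (A.vanishingCalculus (fun x => (x : ℂ) * q x) ψ)).re = ∫ x, x * ‖q x‖ ^ 2 ∂μ := by
    rw [hinner _ hvxq]
    simp only [hxsq]
    rw [integral_complex_ofReal, Complex.ofReal_re]
  have hi1 : Integrable (fun x => ‖q x‖ ^ 2) μ := by
    have := (hint _ (hq.star.mul hq)).re
    simpa only [hsq, RCLike.re_to_complex, Complex.ofReal_re] using this
  have hi2 : Integrable (fun x => x * ‖q x‖ ^ 2) μ := by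
    have := (hint _ (hq.star.mul hvxq)).re
    simpa only [hxsq, RCLike.re_to_complex, Complex.ofReal_re] using this
  have hnonneg : ∀ x, 0 ≤ γ * ‖q x‖ ^ 2 - x * ‖q x‖ ^ 2 := fun x => by
    rcases le_or_gt γ x with hx | hx
    · simp [qdef, hdef, max_eq_right (sub_nonpos.2 hx)]
    · rw [← sub_mul]
      exact mul_nonneg (sub_nonneg.2 hx.le) (sq_nonneg _)
  have hzero : ∫ x, (γ * ‖q x‖ ^ 2 - x * ‖q x‖ ^ 2) ∂μ = 0 := by
    refine le_antisymm ?_ (integral_nonneg hnonneg)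
    rw [integral_sub (hi1.const_mul γ) hi2, integral_const_mul, ← h1, ← h2]
    linarith
  rw [integral_eq_zero_iff_of_nonneg hnonneg ((hi1.const_mul γ).sub hi2)] at hzero
  filter_upwards [hzero] with x hx
  by_contra! hlt
  have hm : max (γ - x) 0 ≠ 0 := by
    rw [max_eq_left (sub_nonneg.2 hlt.le)]
    exact (sub_pos.2 hlt).ne'
  have hq0 : q x ≠ 0 := by
    have h3 := inv_ne_zero (ofReal_sub_ne_zero hI x)
    exact mul_ne_zero h3 (mul_ne_zero (mul_ne_zero (by exact_mod_cast hm) h3) h3)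
  have h4 : 0 < γ * ‖q x‖ ^ 2 - x * ‖q x‖ ^ 2 := by
    rw [← sub_mul]
    have := norm_pos_iff.2 hq0
    exact mul_pos (sub_pos.2 hlt) (by positivity)
  exact h4.ne' hx

/-- The bounded continuous function that agrees with `x ↦ e^{-tx}` on `[γ, ∞)`. -/
def heatKernel (γ t x : ℝ) : ℂ := (Real.exp (-(t * γ)) * Real.exp (-(t * |x - γ|)) : ℝ)

theorem continuous_heatKernel (γ t : ℝ) : Continuous (heatKernel γ t) := by
  unfold heatKernel
  fun_prop

theorem norm_heatKernel_le (γ : ℝ) {t : ℝ} (ht : 0 ≤ t) (x : ℝ) :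
    ‖heatKernel γ t x‖ ≤ Real.exp (-(t * γ)) := by
  rw [heatKernel, Complex.norm_real, Real.norm_of_nonneg (by positivity)]
  refine mul_le_of_le_one_right (Real.exp_pos _).le (Real.exp_le_one_iff.2 ?_)
  have := mul_nonneg ht (abs_nonneg (x - γ))
  linarith

theorem isVanishing_heatKernel (γ : ℝ) {t : ℝ} (ht : 0 < t) : IsVanishing (heatKernel γ t) := by
  refine ⟨continuous_heatKernel γ t, ?_⟩
  have h1 : Tendsto (fun x : ℝ => t * |x - γ|) (cocompact ℝ) atTop := by
    refine Tendsto.const_mul_atTop ht ?_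
    have h2 : Tendsto (fun x : ℝ => ‖x‖ - |γ|) (cocompact ℝ) atTop :=
      tendsto_atTop_add_const_right _ _ tendsto_norm_cocompact_atTop
    exact tendsto_atTop_mono (fun x => abs_sub_abs_le_abs_sub x γ) h2
  have h3 := (Real.tendsto_exp_neg_atTop_nhds_zero.comp h1).const_mul (Real.exp (-(t * γ)))
  rw [mul_zero] at h3
  exact (Complex.continuous_ofReal.tendsto' 0 0 rfl).comp h3

/-- The kernel differs from `e^{-tx}` only below `γ`, which spectral measures do not charge. A
common `γ` gives one bounded function for `A` and all `A_n`. -/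
theorem heatSemigroup_eq (hA : IsSelfAdjoint A) (hγ : A.IsBoundedBelowBy γ) {t : ℝ} (ht : 0 ≤ t) :
    A.heatSemigroup t = A.functionOf (heatKernel γ t) := by
  refine functionOf_congr hA (continuous_heatKernel γ t) (norm_heatKernel_le γ ht) fun ψ μ hμ => ?_
  filter_upwards [hμ.ae_ge hA hγ] with x hx
  rw [heatKernel, abs_of_nonneg (sub_nonneg.2 hx), ← Real.exp_add, Complex.ofReal_exp]
  congr 1
  push_cast
  ring

theorem heatSemigroup_zero (hA : IsSelfAdjoint A) : A.heatSemigroup 0 = 1 := by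
  rw [← functionOf_one hA, heatSemigroup]
  simp

end LinearPMap

/-! ### Asymptotic intertwining and its stability -/

section Intertwining

variable {H : Type*} [NormedAddCommGroup H] [InnerProductSpace ℂ H]
  {K : ℕ → Type*} [∀ n, NormedAddCommGroup (K n)] [∀ n, InnerProductSpace ℂ (K n)]

/-- A class of bounded sequences of vectors that is stable under bounded operators. -/
structure IsTestClass (𝒮 : Set (ℕ → H)) : Prop where
  bounded : ∀ x ∈ 𝒮, ∃ M : ℝ, ∀ n, ‖x n‖ ≤ M
  map_mem : ∀ x ∈ 𝒮, ∀ S : H →L[ℂ] H, (fun n => S (x n)) ∈ 𝒮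

/-- The class for strong convergence. -/
theorem isTestClass_const : IsTestClass (Set.range fun (ψ : H) (_ : ℕ) => ψ) where
  bounded := by
    rintro _ ⟨ψ, rfl⟩
    exact ⟨‖ψ‖, fun _ => le_rfl⟩
  map_mem := by
    rintro _ ⟨ψ, rfl⟩ S
    exact ⟨S ψ, rfl⟩

/-- The class for norm convergence; see `AsymptoticallyIntertwines.tendsto_norm`. -/
theorem isTestClass_bounded : IsTestClass {x : ℕ → H | ∃ M : ℝ, ∀ n, ‖x n‖ ≤ M} where
  bounded _ hx := hx
  map_mem := by
    rintro x ⟨M, hM⟩ S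
    exact ⟨‖S‖ * M, fun n => (S.le_opNorm _).trans (by gcongr; exact hM n)⟩

/-- The operators `T n` are asymptotically intertwined with `S` by the operators `J n`, along the
sequences of the class `𝒮`. -/
def AsymptoticallyIntertwines (𝒮 : Set (ℕ → H)) (J : ∀ n, H →L[ℂ] K n) (T : ∀ n, K n →L[ℂ] K n)
    (S : H →L[ℂ] H) : Prop :=
  ∀ x ∈ 𝒮, Tendsto (fun n => ‖T n (J n (x n)) - J n (S (x n))‖) atTop (𝓝 0)

namespace AsymptoticallyIntertwines

variable {𝒮 : Set (ℕ → H)} {J : ∀ n, H →L[ℂ] K n} {T T' : ∀ n, K n →L[ℂ] K n} {S S' : H →L[ℂ] H}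

theorem scalar (r : ℂ) : AsymptoticallyIntertwines 𝒮 J
    (fun n => algebraMap ℂ (K n →L[ℂ] K n) r) (algebraMap ℂ (H →L[ℂ] H) r) :=
  fun x _ => by simp [Algebra.algebraMap_eq_smul_one]

theorem add (h : AsymptoticallyIntertwines 𝒮 J T S) (h' : AsymptoticallyIntertwines 𝒮 J T' S') :
    AsymptoticallyIntertwines 𝒮 J (fun n => T n + T' n) (S + S') := fun x hx => by
  refine squeeze_zero (fun _ => norm_nonneg _) (fun n => ?_)
    (by simpa using (h x hx).add (h' x hx))
  simp only [_root_.add_apply, map_add]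
  rw [add_sub_add_comm]
  exact norm_add_le _ _

/-- `T_n T'_n J_n - J_n S S' = T_n (T'_n J_n - J_n S') + (T_n J_n - J_n S) S'`; the last term is why
the class must be stable under `S'`. -/
theorem mul (h𝒮 : IsTestClass 𝒮) {C : ℝ} (hT : ∀ n, ‖T n‖ ≤ C)
    (h : AsymptoticallyIntertwines 𝒮 J T S) (h' : AsymptoticallyIntertwines 𝒮 J T' S') :
    AsymptoticallyIntertwines 𝒮 J (fun n => T n * T' n) (S * S') := fun x hx => by
  refine squeeze_zero (fun _ => norm_nonneg _) (fun n => ?_)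
    (by simpa using ((h' x hx).const_mul C).add (h _ (h𝒮.map_mem x hx S')))
  simp only [mul_apply_eq_comp]
  rw [← sub_add_sub_cancel _ (T n (J n (S' (x n)))), ← map_sub]
  exact (norm_add_le _ _).trans (add_le_add_left ((T n).le_of_opNorm_le (hT n) _) _)

theorem of_approx (h𝒮 : IsTestClass 𝒮) {C : ℝ} (hJ : ∀ n, ‖J n‖ ≤ C)
    (h : ∀ ε : ℝ, 0 < ε → ∃ (T' : ∀ n, K n →L[ℂ] K n) (S' : H →L[ℂ] H), (∀ n, ‖T n - T' n‖ ≤ ε) ∧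
      ‖S - S'‖ ≤ ε ∧ AsymptoticallyIntertwines 𝒮 J T' S') :
    AsymptoticallyIntertwines 𝒮 J T S := fun x hx => by
  obtain ⟨M, hM⟩ := h𝒮.bounded x hx
  have hM0 : 0 ≤ M := (norm_nonneg _).trans (hM 0)
  have hC0 : 0 ≤ C := (norm_nonneg _).trans (hJ 0)
  rw [Metric.tendsto_atTop]
  intro ε hε
  set δ := ε / (4 * (C * M + 1)) with hδ
  have hδ0 : 0 < δ := by positivity
  have hδ1 : δ * (C * M) ≤ ε / 4 := by
    have : δ * (C * M + 1) = ε / 4 := by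
      rw [hδ]
      field_simp
    linarith
  obtain ⟨T', S', hT, hS, hTS⟩ := h δ hδ0
  obtain ⟨N, hN⟩ := Metric.tendsto_atTop.1 (hTS x hx) (ε / 2) (by positivity)
  refine ⟨N, fun n hn => ?_⟩
  have h1 := hN n hn
  rw [dist_zero_right, norm_norm] at h1 ⊢
  have hJx : ‖J n (x n)‖ ≤ C * M := (J n).le_of_opNorm_le_of_le (hJ n) (hM n)
  have h2 : ‖(T n - T' n) (J n (x n))‖ ≤ ε / 4 :=
    ((T n - T' n).le_of_opNorm_le_of_le (hT n) hJx).trans hδ1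
  have h3 : ‖J n ((S - S') (x n))‖ ≤ ε / 4 := by
    refine ((J n).le_of_opNorm_le_of_le (hJ n)
      ((S - S').le_of_opNorm_le_of_le hS (hM n))).trans ?_
    linarith
  have h4 : T n (J n (x n)) - J n (S (x n)) = (T n - T' n) (J n (x n)) +
      (T' n (J n (x n)) - J n (S' (x n))) - J n ((S - S') (x n)) := by
    simp only [_root_.sub_apply, map_sub]
    abel
  rw [h4]
  have h5 := norm_sub_le ((T n - T' n) (J n (x n)) + (T' n (J n (x n)) - J n (S' (x n))))
    (J n ((S - S') (x n)))
  have h6 := norm_add_le ((T n - T' n) (J n (x n))) (T' n (J n (x n)) - J n (S' (x n)))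
  linarith

theorem tendsto_norm (h : AsymptoticallyIntertwines {x : ℕ → H | ∃ M : ℝ, ∀ n, ‖x n‖ ≤ M} J T S) :
    Tendsto (fun n => ‖T n ∘L J n - J n ∘L S‖) atTop (𝓝 0) := by
  -- Vectors in the unit ball that attain at least half of the norm form an admissible bounded
  -- sequence.
  have hx : ∀ n, ∃ x : H, ‖x‖ ≤ 1 ∧
      ‖T n ∘L J n - J n ∘L S‖ ≤ 2 * ‖(T n ∘L J n - J n ∘L S) x‖ := fun n => by
    rcases (norm_nonneg (T n ∘L J n - J n ∘L S)).eq_or_lt with h0 | h0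
    · exact ⟨0, by simp, by simp [← h0]⟩
    · obtain ⟨x, hx1, hx2⟩ := (T n ∘L J n - J n ∘L S).exists_lt_apply_of_lt_opNorm (half_lt_self h0)
      exact ⟨x, hx1.le, by linarith⟩
  choose x hx1 hx2 using hx
  exact squeeze_zero (fun _ => norm_nonneg _) hx2 (by simpa using (h x ⟨1, hx1⟩).const_mul 2)

variable [CompleteSpace H] [∀ n, CompleteSpace (K n)]
  {A : H →ₗ.[ℂ] H} {An : ∀ n, K n →ₗ.[ℂ] K n}

open LinearPMap

/-- The resolvent identity factors `R_n(w) J_n - J_n R(w)` as `(1 + (w - z) R_n(w)) (R_n(z) J_n -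
J_n R(z)) (1 + (w - z) R(w))`. As `w` is non-real, the left factor is bounded uniformly in `n`; the
point `z` may be real. -/
theorem resolvent (hA : IsSelfAdjoint A) (hAn : ∀ n, IsSelfAdjoint (An n)) (h𝒮 : IsTestClass 𝒮)
    {z w : ℂ} (hz : z ∈ A.resolventSet) (hzn : ∀ n, z ∈ (An n).resolventSet) (hw : w.im ≠ 0)
    (h : AsymptoticallyIntertwines 𝒮 J (fun n => (An n).resolvent z) (A.resolvent z)) :
    AsymptoticallyIntertwines 𝒮 J (fun n => (An n).resolvent w) (A.resolvent w) := fun x hx => by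
  have h1 := h _ (h𝒮.map_mem x hx (1 + (w - z) • A.resolvent w))
  refine squeeze_zero (fun _ => norm_nonneg _) (fun n => ?_)
    (by simpa only [mul_zero] using h1.const_mul (1 + ‖w - z‖ * |w.im|⁻¹))
  have h2 := congrArg (fun T : H →L[ℂ] H => T (x n))
    (resolvent_sub_resolvent hz (hA.mem_resolventSet hw))
  have h3 := congrArg (fun T : K n →L[ℂ] K n => T (J n (x n) + (w - z) • J n (A.resolvent w (x n))))
    (resolvent_sub_resolvent ((hAn n).mem_resolventSet hw) (hzn n))
  simp only [_root_.sub_apply, _root_.smul_apply, ContinuousLinearMap.comp_apply] at h2 h3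
  have h4 : (An n).resolvent w (J n (x n)) - J n (A.resolvent w (x n)) =
      (1 + (w - z) • (An n).resolvent w)
        ((An n).resolvent z (J n ((1 + (w - z) • A.resolvent w) (x n))) -
          J n (A.resolvent z ((1 + (w - z) • A.resolvent w) (x n)))) := by
    have h5 : A.resolvent z ((1 + (w - z) • A.resolvent w) (x n)) = A.resolvent w (x n) := by
      rw [← sub_eq_zero] at h2 ⊢
      rw [← h2]
      simp only [_root_.add_apply, one_apply_eq_self, _root_.smul_apply, _root_.map_add,
        _root_.map_smul]
      module
    rw [h5]
    simp only [_root_.add_apply, one_apply_eq_self, _root_.smul_apply, _root_.map_add,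
      _root_.map_smul, _root_.map_sub] at h3 ⊢
    rw [← sub_eq_zero] at h3 ⊢
    rw [← h3]
    module
  rw [h4]
  refine ContinuousLinearMap.le_of_opNorm_le _ ?_ _
  refine (norm_add_le _ _).trans (add_le_add ContinuousLinearMap.norm_id_le ?_)
  rw [norm_smul]
  gcongr
  exact norm_resolvent_le (hAn n) hw

/-- All spectra of the resolvents at `i` lie in one compact circle, so the calculi are contractive
homomorphisms from a single algebra `C(resolventCircle, ℂ)`, and Stone–Weierstrass induction applies
to all of them at once. -/
theorem vanishingCalculus (hA : IsSelfAdjoint A) (hAn : ∀ n, IsSelfAdjoint (An n))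
    (h𝒮 : IsTestClass 𝒮) {C : ℝ} (hJ : ∀ n, ‖J n‖ ≤ C)
    {z : ℂ} (hz : z ∈ A.resolventSet) (hzn : ∀ n, z ∈ (An n).resolventSet)
    (h : AsymptoticallyIntertwines 𝒮 J (fun n => (An n).resolvent z) (A.resolvent z))
    {f : ℝ → ℂ} (hf : IsVanishing f) :
    AsymptoticallyIntertwines 𝒮 J (fun n => (An n).vanishingCalculus f)
      (A.vanishingCalculus f) := by
  have hI : Complex.I.im ≠ 0 := by simp
  have hI' : (star Complex.I).im ≠ 0 := by simp
  have hn := isStarNormal_resolvent hA hI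
  have hnn := fun n => isStarNormal_resolvent (hAn n) hI
  have : CompactSpace resolventCircle := isCompact_iff_compactSpace.1 isCompact_resolventCircle
  let Φ := cfcHomSuperset hn (spectrum_resolvent_subset hA)
  let Φn := fun n => cfcHomSuperset (hnn n) (spectrum_resolvent_subset (hAn n))
  have hΦ : ∀ g, ‖Φ g‖ ≤ ‖g‖ := fun g => NonUnitalStarAlgHom.norm_apply_le Φ g
  have hΦn : ∀ n g, ‖Φn n g‖ ≤ ‖g‖ := fun n g => NonUnitalStarAlgHom.norm_apply_le (Φn n) g
  have key : ∀ g : C(resolventCircle, ℂ),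
      AsymptoticallyIntertwines 𝒮 J (fun n => Φn n g) (Φ g) := fun g => by
    induction g using ContinuousMap.induction_on_of_compact with
    | const r =>
      have h1 : Φ (.const _ r) = algebraMap ℂ _ r := AlgHomClass.commutes Φ r
      have h2 : ∀ n, Φn n (.const _ r) = algebraMap ℂ _ r := fun n =>
        AlgHomClass.commutes (Φn n) r
      simpa only [h1, h2] using scalar r
    | id =>
      have h1 : Φ (.restrict _ (.id ℂ)) = A.resolvent Complex.I := cfcHomSuperset_id _ _
      have h2 : ∀ n, Φn n (.restrict _ (.id ℂ)) = (An n).resolvent Complex.I := fun n =>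
        cfcHomSuperset_id _ _
      simpa only [h1, h2] using h.resolvent hA hAn h𝒮 hz hzn hI
    -- Intertwining does not pass to adjoints in general; but `R(i)* = R(-i)` is again a resolvent
    -- at a non-real point.
    | star_id =>
      have h1 : Φ (.restrict _ (.id ℂ)) = A.resolvent Complex.I := cfcHomSuperset_id _ _
      have h2 : ∀ n, Φn n (.restrict _ (.id ℂ)) = (An n).resolvent Complex.I := fun n =>
        cfcHomSuperset_id _ _
      have h3 := fun n => adjoint_resolvent (hAn n) hI
      simp only [map_star, h1, h2, ContinuousLinearMap.star_eq_adjoint, adjoint_resolvent hA hI, h3]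
      exact h.resolvent hA hAn h𝒮 hz hzn hI'
    | add f g hf hg =>
      simp only [_root_.map_add]
      exact hf.add hg
    | mul f g hf hg =>
      simp only [map_mul]
      exact mul h𝒮 (fun n => hΦn n f) hf hg
    | frequently f hf =>
      refine of_approx h𝒮 hJ fun ε hε => ?_
      obtain ⟨g, hg, hgp⟩ := frequently_iff.1 hf (Metric.closedBall_mem_nhds f hε)
      rw [Metric.mem_closedBall, dist_comm, dist_eq_norm] at hg
      refine ⟨_, _, fun n => ?_, ?_, hgp⟩
      · rw [← _root_.map_sub]
        exact (hΦn n _).trans hg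
      · rw [← _root_.map_sub]
        exact (hΦ _).trans hg
  have h1 : A.vanishingCalculus f = Φ ⟨_, hf.continuousOn_resolventPullback.domRestrict⟩ :=
    cfc_apply _ _ hn (continuousOn_resolventPullback_spectrum hA hf)
  have h2 : ∀ n, (An n).vanishingCalculus f =
      Φn n ⟨_, hf.continuousOn_resolventPullback.domRestrict⟩ := fun n =>
    cfc_apply _ _ (hnn n) (continuousOn_resolventPullback_spectrum (hAn n) hf)
  simp only [h1, h2]
  exact key _

end AsymptoticallyIntertwines

end Intertwining

/-! ### From resolvent convergence to convergence of functions -/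

section Convergence

open LinearPMap

variable {H : Type*} [NormedAddCommGroup H] [InnerProductSpace ℂ H]
  {K : ℕ → Type*} [∀ n, NormedAddCommGroup (K n)] [∀ n, InnerProductSpace ℂ (K n)]
  {J : ∀ n, H →L[ℂ] K n} {A : H →ₗ.[ℂ] H} {An : ∀ n, K n →ₗ.[ℂ] K n}

theorem mem_resolventSet_of_mem_commonResolventSet {z : ℂ} (hz : z ∈ commonResolventSet A An) :
    z ∈ A.resolventSet ∧ ∀ n, z ∈ (An n).resolventSet := by
  have h := fun h => hz (subset_closure h)
  exact ⟨by_contra fun h1 => h (.inl h1),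
    fun n => by_contra fun h1 => h (.inr (Set.mem_iUnion.2 ⟨n, h1⟩))⟩

variable [CompleteSpace H] [∀ n, CompleteSpace (K n)]

/-- Pair `φ = (A - z) R φ` with `R φ` and use that `⟪A R φ, R φ⟫` is real. This turns weak
information on the resolvent into its norm. -/
theorem LinearPMap.im_inner_resolvent (hA : IsSelfAdjoint A) {z : ℂ} (hz : z.im ≠ 0) (φ : H) :
    (inner ℂ φ (A.resolvent z φ)).im = z.im * ‖A.resolvent z φ‖ ^ 2 := by
  obtain ⟨hu, eu⟩ := (isResolventAt_resolvent (hA.mem_resolventSet hz)).1 φ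
  have h1 : (inner ℂ (A ⟨_, hu⟩) (A.resolvent z φ)).im = 0 := by
    rw [← Complex.conj_eq_iff_im, inner_conj_symm]
    exact (hA.inner_apply_eq ⟨_, hu⟩ ⟨_, hu⟩).symm
  have h2 : inner ℂ φ (A.resolvent z φ) = inner ℂ (A ⟨_, hu⟩) (A.resolvent z φ) -
      (starRingEnd ℂ) z * ((‖A.resolvent z φ‖ ^ 2 : ℝ) : ℂ) := by
    rw [sub_eq_iff_eq_add.1 eu, inner_add_left, inner_smul_left, inner_self_eq_norm_sq_to_K,
      Complex.ofReal_pow]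
    exact (add_sub_cancel_right _ _).symm
  rw [h2, Complex.sub_im, h1, Complex.im_mul_ofReal]
  simp

/-- In the expansion of `‖R_n J_n ψ - J_n R ψ‖²` all three terms tend to multiples of `‖R ψ‖²`, with
coefficients `1 - 2 + 1 = 0`. -/
theorem StrongIdentification.intertwines_resolvent (hJ : StrongIdentification J)
    (hA : IsSelfAdjoint A) (hAn : ∀ n, IsSelfAdjoint (An n)) {z : ℂ} (hz : z.im ≠ 0)
    (h : ∀ ψ : H, Tendsto (fun n => (J n).adjoint ((An n).resolvent z (J n ψ))) atTop
      (𝓝 (A.resolvent z ψ))) :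
    AsymptoticallyIntertwines (Set.range fun (ψ : H) (_ : ℕ) => ψ) J
      (fun n => (An n).resolvent z) (A.resolvent z) := by
  rintro _ ⟨ψ, rfl⟩
  have h1 : Tendsto (fun n => ‖(An n).resolvent z (J n ψ)‖ ^ 2) atTop
      (𝓝 (‖A.resolvent z ψ‖ ^ 2)) := by
    have h2 := ((Complex.continuous_im.tendsto _).comp
      ((tendsto_const_nhds (x := ψ)).inner (𝕜 := ℂ) (h ψ))).const_mul z.im⁻¹
    rw [im_inner_resolvent hA hz, inv_mul_cancel_left₀ hz] at h2
    refine h2.congr fun n => ?_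
    simp only [Function.comp_apply]
    rw [ContinuousLinearMap.adjoint_inner_right, im_inner_resolvent (hAn n) hz,
      inv_mul_cancel_left₀ hz]
  have h2 : Tendsto (fun n => (inner ℂ ((An n).resolvent z (J n ψ)) (J n (A.resolvent z ψ))).re)
      atTop (𝓝 (‖A.resolvent z ψ‖ ^ 2)) := by
    have h3 := (Complex.continuous_re.tendsto _).comp
      ((h ψ).inner (𝕜 := ℂ) (tendsto_const_nhds (x := A.resolvent z ψ)))
    have h4 : (inner ℂ (A.resolvent z ψ) (A.resolvent z ψ)).re = ‖A.resolvent z ψ‖ ^ 2 :=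
      inner_self_eq_norm_sq (𝕜 := ℂ) _
    rw [h4] at h3
    refine h3.congr fun n => ?_
    simp only [Function.comp_apply]
    rw [ContinuousLinearMap.adjoint_inner_left]
  have h3 : Tendsto (fun n => ‖J n (A.resolvent z ψ)‖ ^ 2) atTop (𝓝 (‖A.resolvent z ψ‖ ^ 2)) := by
    have h3 := (Complex.continuous_re.tendsto _).comp
      ((tendsto_const_nhds (x := A.resolvent z ψ)).inner (𝕜 := ℂ) (hJ.2 (A.resolvent z ψ)))
    have h4 : (inner ℂ (A.resolvent z ψ) (A.resolvent z ψ)).re = ‖A.resolvent z ψ‖ ^ 2 :=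
      inner_self_eq_norm_sq (𝕜 := ℂ) _
    rw [h4] at h3
    refine h3.congr fun n => ?_
    simp only [Function.comp_apply]
    rw [ContinuousLinearMap.adjoint_inner_right]
    exact inner_self_eq_norm_sq (𝕜 := ℂ) _
  have h4 : Tendsto (fun n => ‖(An n).resolvent z (J n ψ) - J n (A.resolvent z ψ)‖ ^ 2) atTop
      (𝓝 0) := by
    have h5 := (h1.sub (h2.const_mul 2)).add h3
    have h6 : ‖A.resolvent z ψ‖ ^ 2 - 2 * ‖A.resolvent z ψ‖ ^ 2 + ‖A.resolvent z ψ‖ ^ 2 = 0 := by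
      ring
    rw [h6] at h5
    exact h5.congr fun n => (norm_sub_sq (𝕜 := ℂ) _ _).symm
  have h5 := (Real.continuous_sqrt.tendsto _).comp h4
  rw [Real.sqrt_zero] at h5
  exact h5.congr fun n => Real.sqrt_sq (norm_nonneg _)

/-- With `E = J J* - 1`, `T = J (J* T J) J* - J J* T E - E T`, and the terms containing `E` are
absorbed. For a real point `z` this replaces the bound `|Im z|⁻¹` on the resolvents. -/
theorem eventually_norm_le_of_identification {C : ℝ} (hJ : ∀ n, ‖J n‖ ≤ C)
    (hE : Tendsto (fun n => ‖J n ∘L (J n).adjoint - ContinuousLinearMap.id ℂ (K n)‖) atTop (𝓝 0))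
    {T : ∀ n, K n →L[ℂ] K n} {M : ℝ}
    (hT : ∀ᶠ n in atTop, ‖(J n).adjoint ∘L T n ∘L J n‖ ≤ M) :
    ∀ᶠ n in atTop, ‖T n‖ ≤ 2 * (C * M * C) := by
  have hC : 0 ≤ C := (norm_nonneg _).trans (hJ 0)
  -- Makes `‖E‖ (1 + C²) ≤ 1/2`, so half of `‖T n‖` is absorbed; hence the factor `2`.
  have hε : 0 < 1 / (2 * (1 + C * C)) := by positivity
  filter_upwards [hT, hE.eventually_lt_const hε] with n hn hn'
  set E := J n ∘L (J n).adjoint - ContinuousLinearMap.id ℂ (K n) with hEdef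
  have hM : 0 ≤ M := (norm_nonneg _).trans hn
  have hJa : ‖(J n).adjoint‖ ≤ C := by
    rw [LinearIsometryEquiv.norm_map]
    exact hJ n
  have hP : ‖J n ∘L (J n).adjoint‖ ≤ C * C :=
    (ContinuousLinearMap.opNorm_comp_le _ _).trans (mul_le_mul (hJ n) hJa (norm_nonneg _) hC)
  have hdec : T n = J n ∘L ((J n).adjoint ∘L T n ∘L J n) ∘L (J n).adjoint -
      (J n ∘L (J n).adjoint) ∘L T n ∘L E - E ∘L T n := by
    ext x
    simp [hEdef]
  have h1 : ‖J n ∘L ((J n).adjoint ∘L T n ∘L J n) ∘L (J n).adjoint‖ ≤ C * M * C := by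
    refine (ContinuousLinearMap.opNorm_comp_le _ _).trans ?_
    rw [mul_assoc]
    refine mul_le_mul (hJ n) ?_ (norm_nonneg _) hC
    exact (ContinuousLinearMap.opNorm_comp_le _ _).trans (mul_le_mul hn hJa (norm_nonneg _) hM)
  have h2 : ‖(J n ∘L (J n).adjoint) ∘L T n ∘L E‖ ≤ C * C * (‖T n‖ * ‖E‖) :=
    (ContinuousLinearMap.opNorm_comp_le _ _).trans
      (mul_le_mul hP (ContinuousLinearMap.opNorm_comp_le _ _) (norm_nonneg _) (by positivity))
  have h3 : ‖E ∘L T n‖ ≤ ‖E‖ * ‖T n‖ := ContinuousLinearMap.opNorm_comp_le _ _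
  have h4 : ‖T n‖ ≤ C * M * C + C * C * (‖T n‖ * ‖E‖) + ‖E‖ * ‖T n‖ := by
    calc ‖T n‖ = ‖_‖ := congrArg norm hdec
      _ ≤ _ := norm_sub_le _ _
      _ ≤ _ := add_le_add_left (norm_sub_le _ _) _
      _ ≤ _ := by gcongr
  have h5 : ‖E‖ * (1 + C * C) ≤ 1 / 2 := by
    rw [lt_div_iff₀ (by positivity)] at hn'
    linarith
  have h6 := mul_le_mul_of_nonneg_right h5 (norm_nonneg (T n))
  linarith

theorem NormIdentification.intertwines_resolvent (hJ : NormIdentification J) {z : ℂ}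
    (h : Tendsto (fun n => ‖(J n).adjoint ∘L (An n).resolvent z ∘L J n - A.resolvent z‖)
      atTop (𝓝 0)) :
    AsymptoticallyIntertwines {x : ℕ → H | ∃ M : ℝ, ∀ n, ‖x n‖ ≤ M} J
      (fun n => (An n).resolvent z) (A.resolvent z) := by
  obtain ⟨⟨C, hC⟩, -, hE⟩ := hJ
  have hC0 : 0 ≤ C := (norm_nonneg _).trans (hC 0)
  have hbd : ∀ᶠ n in atTop, ‖(J n).adjoint ∘L (An n).resolvent z ∘L J n‖ ≤ 1 + ‖A.resolvent z‖ := by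
    filter_upwards [h.eventually_lt_const one_pos] with n hn
    have := norm_add_le ((J n).adjoint ∘L (An n).resolvent z ∘L J n - A.resolvent z)
      (A.resolvent z)
    rw [sub_add_cancel] at this
    linarith
  have hbd' := eventually_norm_le_of_identification hC hE hbd
  set B := 2 * (C * (1 + ‖A.resolvent z‖) * C) with hB
  rintro x ⟨M, hM⟩
  have hM0 : 0 ≤ M := (norm_nonneg _).trans (hM 0)
  have hlim := (hE.mul_const (B * (C * M))).add ((h.mul_const M).const_mul C)
  simp only [zero_mul, mul_zero, add_zero] at hlim
  refine squeeze_zero' (.of_forall fun _ => norm_nonneg _) ?_ hlim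
  filter_upwards [hbd'] with n hn
  -- The first term is small by hypothesis, the second because `J J* - 1 → 0` while the resolvents
  -- are eventually bounded.
  have h1 : (An n).resolvent z (J n (x n)) - J n (A.resolvent z (x n)) =
      J n (((J n).adjoint ∘L (An n).resolvent z ∘L J n - A.resolvent z) (x n)) -
        (J n ∘L (J n).adjoint - ContinuousLinearMap.id ℂ (K n))
          ((An n).resolvent z (J n (x n))) := by
    simp
  rw [h1]
  refine (norm_sub_le _ _).trans ?_
  rw [add_comm]
  refine add_le_add ?_ ?_
  · refine (ContinuousLinearMap.le_opNorm _ _).trans ?_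
    gcongr
    exact ContinuousLinearMap.le_of_opNorm_le_of_le _ hn
      (ContinuousLinearMap.le_of_opNorm_le_of_le _ (hC n) (hM n))
  · exact ContinuousLinearMap.le_of_opNorm_le_of_le _ (hC n)
      (ContinuousLinearMap.le_of_opNorm_le_of_le _ le_rfl (hM n))

/-- Strong resolvent convergence carries over to bounded continuous functions. -/
theorem GeneralizedStrongResolventConvergence.tendsto_functionOf
    (h : GeneralizedStrongResolventConvergence J An A) (hA : IsSelfAdjoint A)
    (hAn : ∀ n, IsSelfAdjoint (An n)) {f : ℝ → ℂ} (hf : Continuous f) {C : ℝ}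
    (hC : ∀ x, ‖f x‖ ≤ C) (ψ : H) :
    Tendsto (fun n => (J n).adjoint ((An n).functionOf f (J n ψ))) atTop
      (𝓝 (A.functionOf f ψ)) := by
  obtain ⟨hJ, z, -, hz, hlim⟩ := h
  obtain ⟨⟨B, hB⟩, hJJ⟩ := id hJ
  have hB0 : 0 ≤ B := (norm_nonneg _).trans (hB 0)
  have hC0 : 0 ≤ C := (norm_nonneg _).trans (hC 0)
  have hI : Complex.I.im ≠ 0 := by simp
  have hcalc : ∀ g, IsVanishing g → _ := fun g hg =>
    (hJ.intertwines_resolvent hA hAn hz hlim).vanishingCalculus hA hAn isTestClass_const hB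
      (hA.mem_resolventSet hz) (fun n => (hAn n).mem_resolventSet hz) hg
  have hvI := isVanishing_inv_ofReal_sub hI
  have hD : ∀ n, ‖(An n).functionOf f ∘L J n - J n ∘L A.functionOf f‖ ≤ C * B + B * C := fun n => by
    refine (norm_sub_le _ _).trans (add_le_add ?_ ?_) <;>
      refine (ContinuousLinearMap.opNorm_comp_le _ _).trans ?_
    · exact mul_le_mul (norm_functionOf_le (hAn n) hf hC) (hB n) (norm_nonneg _) hC0
    · exact mul_le_mul (hB n) (norm_functionOf_le hA hf hC) (norm_nonneg _) hB0
  -- On vectors `R_A(i) φ`, the two vanishing functions `f(x)(x - i)⁻¹` and `(x - i)⁻¹` control the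
  -- difference; density and the bound `hD` give all `ψ`.
  have hint : Tendsto (fun n => ‖((An n).functionOf f ∘L J n - J n ∘L A.functionOf f) ψ‖)
      atTop (𝓝 0) := by
    refine tendsto_norm_zero_of_dense hD (dense_range_resolvent hA hI) ?_ ψ
    rintro _ ⟨φ, rfl⟩
    have h1 := hcalc _ hvI _ ⟨φ, rfl⟩
    have h2 := hcalc _ (hvI.bounded_mul hf hC) _ ⟨φ, rfl⟩
    refine squeeze_zero (fun _ => norm_nonneg _) (fun n => ?_)
      (by simpa only [mul_zero, add_zero] using h2.add (h1.const_mul C))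
    have h3 : ((An n).functionOf f ∘L J n - J n ∘L A.functionOf f) (A.resolvent Complex.I φ) =
        ((An n).vanishingCalculus (fun x => f x * ((x : ℂ) - Complex.I)⁻¹) (J n φ) -
          J n (A.vanishingCalculus (fun x => f x * ((x : ℂ) - Complex.I)⁻¹) φ)) -
        (An n).functionOf f ((An n).vanishingCalculus (fun x => ((x : ℂ) - Complex.I)⁻¹) (J n φ) -
          J n (A.vanishingCalculus (fun x => ((x : ℂ) - Complex.I)⁻¹) φ)) := by
      rw [← functionOf_mul_vanishingCalculus hA hf hC hvI,
        ← functionOf_mul_vanishingCalculus (hAn n) hf hC hvI, vanishingCalculus_inv_sub hA hI]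
      simp
    rw [h3]
    refine (norm_sub_le _ _).trans (add_le_add le_rfl ?_)
    exact ContinuousLinearMap.le_of_opNorm_le _ (norm_functionOf_le (hAn n) hf hC) _
  rw [tendsto_iff_norm_sub_tendsto_zero]
  have hJJ' := tendsto_iff_norm_sub_tendsto_zero.1 (hJJ (A.functionOf f ψ))
  refine squeeze_zero (fun _ => norm_nonneg _) (fun n => ?_)
    (by simpa only [mul_zero, add_zero] using (hint.const_mul B).add hJJ')
  have h1 : (J n).adjoint ((An n).functionOf f (J n ψ)) - A.functionOf f ψ =
      (J n).adjoint (((An n).functionOf f ∘L J n - J n ∘L A.functionOf f) ψ) +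
        ((J n).adjoint (J n (A.functionOf f ψ)) - A.functionOf f ψ) := by
    simp
  rw [h1]
  refine (norm_add_le _ _).trans (add_le_add_left ?_ _)
  refine ContinuousLinearMap.le_of_opNorm_le _ ?_ _
  rw [LinearIsometryEquiv.norm_map]
  exact hB n

/-- Norm resolvent convergence carries over to continuous functions vanishing at infinity. -/
theorem GeneralizedNormResolventConvergence.tendsto_functionOf
    (h : GeneralizedNormResolventConvergence J An A) (hA : IsSelfAdjoint A)
    (hAn : ∀ n, IsSelfAdjoint (An n)) {f : ℝ → ℂ} (hf : IsVanishing f) :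
    Tendsto (fun n => ‖(J n).adjoint ∘L (An n).functionOf f ∘L J n - A.functionOf f‖) atTop
      (𝓝 0) := by
  obtain ⟨hJ, z, hz, hlim⟩ := h
  obtain ⟨⟨B, hB⟩, hJJ, -⟩ := id hJ
  obtain ⟨hzA, hzn⟩ := mem_resolventSet_of_mem_commonResolventSet hz
  have hint := ((hJ.intertwines_resolvent hlim).vanishingCalculus hA hAn isTestClass_bounded hB
    hzA hzn hf).tendsto_norm
  simp only [functionOf_eq_vanishingCalculus hA hf, functionOf_eq_vanishingCalculus (hAn _) hf]
  refine squeeze_zero (fun _ => norm_nonneg _) (fun n => ?_)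
    (by simpa only [mul_zero, zero_mul, add_zero] using
      (hint.const_mul B).add (hJJ.mul_const ‖A.vanishingCalculus f‖))
  have h1 : (J n).adjoint ∘L (An n).vanishingCalculus f ∘L J n - A.vanishingCalculus f =
      (J n).adjoint ∘L ((An n).vanishingCalculus f ∘L J n - J n ∘L A.vanishingCalculus f) +
        ((J n).adjoint ∘L J n - ContinuousLinearMap.id ℂ H) ∘L A.vanishingCalculus f := by
    ext x
    simp
  rw [h1]
  refine (norm_add_le _ _).trans (add_le_add ?_ (ContinuousLinearMap.opNorm_comp_le _ _))
  refine (ContinuousLinearMap.opNorm_comp_le _ _).trans ?_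
  gcongr
  rw [LinearIsometryEquiv.norm_map]
  exact hB n

end Convergence

end

/-! ### The main theorem -/

theorem mainTheorem9 {H : Type*} [NormedAddCommGroup H] [InnerProductSpace ℂ H] [CompleteSpace H]
    {K : ℕ → Type*} [∀ n, NormedAddCommGroup (K n)] [∀ n, InnerProductSpace ℂ (K n)]
    [∀ n, CompleteSpace (K n)]
    (J : ∀ n, H →L[ℂ] K n) (A : H →ₗ.[ℂ] H) (An : ∀ n, K n →ₗ.[ℂ] K n)
    (hA : IsSelfAdjoint A) (hAn : ∀ n, IsSelfAdjoint (An n)) :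
    (GeneralizedStrongResolventConvergence J An A →
      ∀ (t : ℝ) (ψ : H),
        Tendsto (fun n => (J n).adjoint ((An n).unitaryGroup t (J n ψ))) atTop
          (𝓝 (A.unitaryGroup t ψ))) ∧
    (∀ γ : ℝ, A.IsBoundedBelowBy γ → (∀ n, (An n).IsBoundedBelowBy γ) →
      (GeneralizedStrongResolventConvergence J An A →
        ∀ t : ℝ, 0 ≤ t → ∀ ψ : H,
          Tendsto (fun n => (J n).adjoint ((An n).heatSemigroup t (J n ψ))) atTop
            (𝓝 (A.heatSemigroup t ψ))) ∧
      (GeneralizedNormResolventConvergence J An A →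
        ∀ t : ℝ, 0 ≤ t →
          Tendsto
            (fun n => ‖(J n).adjoint ∘L (An n).heatSemigroup t ∘L J n - A.heatSemigroup t‖)
            atTop (𝓝 0))) := by
  refine ⟨fun h t ψ => ?_, fun γ hγ hγn => ⟨fun h t ht ψ => ?_, fun h t ht => ?_⟩⟩
  · refine h.tendsto_functionOf hA hAn (by fun_prop) (C := 1) (fun x => ?_) ψ
    rw [Complex.norm_exp]
    simp
  · simp only [LinearPMap.heatSemigroup_eq hA hγ ht,
      LinearPMap.heatSemigroup_eq (hAn _) (hγn _) ht]
    exact h.tendsto_functionOf hA hAn (LinearPMap.continuous_heatKernel γ t)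
      (LinearPMap.norm_heatKernel_le γ ht) ψ
  -- At `t = 0` the function is the constant `1`, which does not vanish at infinity; the claim is
  -- then `‖J_n* J_n - 1‖ → 0`.
  · rcases ht.eq_or_lt with rfl | ht'
    · simp only [LinearPMap.heatSemigroup_zero hA, LinearPMap.heatSemigroup_zero (hAn _)]
      exact h.1.2.1
    · simp only [LinearPMap.heatSemigroup_eq hA hγ ht,
        LinearPMap.heatSemigroup_eq (hAn _) (hγn _) ht]
      exact h.tendsto_functionOf hA hAn (LinearPMap.isVanishing_heatKernel γ ht')
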